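/- Let $S$ be a Polish space with its Borel $\sigma$-field, let $\mu_1,\dots,\mu_n$ be Borel probability measures on $S$, put $\mu=\mu_1\otimes\cdots\otimes\mu_n$ on $S^n$, and let $\gamma_1,\dots,\gamma_n\ge 0$ with $\sum_{k=1}^n\gamma_k=1$ and $\Gamma_j=\sum_{k=1}^j\gamma_k$. For a probability measure $\nu$ on $S^n$ let $\nu^{(j)}$ be its marginal on the first $j$ coordinates, let $H(\cdot\mid\cdot)\in[0,\infty]$ be relative entropy, let $\mathcal R_j=\{\nu: H(\nu^{(j)}\mid\mu^{(j)})\le\Gamma_j\log 2\}$ for $1\le j\le n$, and let $J(\nu)=H(\nu\mid\mu)$ if $\nu\in\bigcap_{j=1}^n\mathcal R_j$ and $J(\nu)=\infty$ otherwise. For a bounded continuous $\varphi:S^n\to\mathbb R$ put $J^*(\varphi)=\sup_\nu\left[\int\varphi\,d\nu-J(\nu)\right]$, the supremum being over all Borel probability measures $\nu$ on $S^n$. Let $\Delta$ be the set of $\mathbf m=(m_1,\dots,m_n)$ with $0<m_1\le\cdots\le m_n\le 1$. For $\mathbf m\in\Delta$ define $\varphi_j:S^j\to\mathbb R$, $0\le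 j\le n$, by $\varphi_n=\varphi$ and $$\varphi_{j-1}(x_1,\dots,x_{j-1})=\frac1{m_j}\log\int\exp\left[m_j\varphi_j(x_1,\dots,x_{j-1},x_j)\right]\mu_j(dx_j),\qquad 1\le j\le n,$$ write $\varphi_0(\mathbf m)$ for the real number $\varphi_0$, and put $$\operatorname{Parisi}(\mathbf m,\varphi)=\sum_{i=1}^n\frac{\gamma_i\log 2}{m_i}+\varphi_0(\mathbf m)-\log 2 .$$ Then for every bounded continuous $\varphi:S^n\to\mathbb R$, $$J^*(\varphi)=\inf_{\mathbf m\in\Delta}\operatorname{Parisi}(\mathbf m,\varphi).$$ -/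

import Mathlib

open MeasureTheory

namespace GREM

noncomputable section

/-- The product measure `μ₁ ⊗ ⋯ ⊗ μₙ` on `Sⁿ`. -/
def prodMeasure {S : Type*} [MeasurableSpace S] {n : ℕ} (μ : Fin n → Measure S) :
    Measure (Fin n → S) :=
  Measure.pi μ

/-- The marginal of a measure on `Sⁿ` on the first `j` coordinates, `0 ≤ j ≤ n`. -/
def marginal {S : Type*} [MeasurableSpace S] {n : ℕ} (ν : Measure (Fin n → S))
    (j : Fin (n + 1)) : Measure (Fin j → S) :=
  ν.map (fun x => Fin.take j j.is_le x)

/-- The partial sums `γ₁ + ⋯ + γⱼ`. The index `j : Fin n` stands for the position `j + 1`. -/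
def partialSum {n : ℕ} (γ : Fin n → ℝ) (j : Fin n) : ℝ :=
  ∑ k ∈ Finset.Iic j, γ k

/-- The set of probability measures `ν` on `Sⁿ` whose marginal on the coordinates up to `j`
(the first `j + 1` ones, as `j : Fin n` counts from `0`) has relative entropy at most
`(γ₁ + ⋯ + γⱼ) log 2` with respect to the corresponding marginal of `μ₁ ⊗ ⋯ ⊗ μₙ`. -/
def entropyConstraint {S : Type*} [MeasurableSpace S] {n : ℕ} (μ : Fin n → Measure S)
    (γ : Fin n → ℝ) (j : Fin n) : Set (ProbabilityMeasure (Fin n → S)) :=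
  {ν | InformationTheory.klDiv (marginal (ν : Measure (Fin n → S)) j.succ)
      (marginal (prodMeasure μ) j.succ) ≤ ENNReal.ofReal (partialSum γ j * Real.log 2)}

open Classical in
/-- The rate function `J`. -/
def rate {S : Type*} [MeasurableSpace S] {n : ℕ} (μ : Fin n → Measure S)
    (γ : Fin n → ℝ) (ν : ProbabilityMeasure (Fin n → S)) : ENNReal :=
  if ν ∈ ⋂ j : Fin n, entropyConstraint μ γ j then
    InformationTheory.klDiv (ν : Measure (Fin n → S)) (prodMeasure μ)
  else ⊤

/-- The Legendre transform `J*(φ) = sup_ν [∫ φ dν - J(ν)]`, the supremum being over all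
probability measures on `Sⁿ` and taken in the extended reals. -/
def legendre {S : Type*} [MeasurableSpace S] {n : ℕ} (μ : Fin n → Measure S)
    (γ : Fin n → ℝ) (φ : (Fin n → S) → ℝ) : EReal :=
  ⨆ ν : ProbabilityMeasure (Fin n → S),
    (((∫ x, φ x ∂(ν : Measure (Fin n → S)) : ℝ) : EReal) - (rate μ γ ν : EReal))

/-- The set `Δ` of sequences `0 < m₁ ≤ m₂ ≤ ⋯ ≤ mₙ ≤ 1`. -/
def Delta (n : ℕ) : Set (Fin n → ℝ) :=
  {m | (∀ i, 0 < m i) ∧ Monotone m ∧ ∀ i, m i ≤ 1}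

/-- The functions `φⱼ : Sʲ → ℝ`, `0 ≤ j ≤ n`: `φₙ = φ`, and `φ_{j-1}` is obtained from `φⱼ` by
`φ_{j-1}(x) = (1 / mⱼ) log ∫ exp (mⱼ φⱼ(x, y)) μⱼ(dy)`. -/
def phi {S : Type*} [MeasurableSpace S] {n : ℕ} (μ : Fin n → Measure S)
    (m : Fin n → ℝ) (φ : (Fin n → S) → ℝ) : (j : Fin (n + 1)) → (Fin j → S) → ℝ :=
  Fin.reverseInduction (motive := fun j : Fin (n + 1) => (Fin j → S) → ℝ) φ
    (fun (i : Fin n) (f : (Fin (i + 1) → S) → ℝ) (x : Fin i → S) =>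
      1 / m i * Real.log (∫ y, Real.exp (m i * f (Fin.snoc (α := fun _ => S) x y)) ∂(μ i)))

theorem phi_last {S : Type*} [MeasurableSpace S] {n : ℕ} (μ : Fin n → Measure S)
    (m : Fin n → ℝ) (φ : (Fin n → S) → ℝ) : phi μ m φ (Fin.last n) = φ := by
  simp [phi]

theorem phi_castSucc {S : Type*} [MeasurableSpace S] {n : ℕ} (μ : Fin n → Measure S)
    (m : Fin n → ℝ) (φ : (Fin n → S) → ℝ) (i : Fin n) (x : Fin i → S) :
    phi μ m φ i.castSucc x =
      1 / m i * Real.log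
        (∫ y, Real.exp (m i * phi μ m φ i.succ (Fin.snoc (α := fun _ => S) x y)) ∂(μ i)) := by
  simp only [phi, Fin.reverseInduction_castSucc]

/-- The real number `φ₀(m)`. -/
def phiZero {S : Type*} [MeasurableSpace S] {n : ℕ} (μ : Fin n → Measure S)
    (m : Fin n → ℝ) (φ : (Fin n → S) → ℝ) : ℝ :=
  phi μ m φ 0 (fun i => i.elim0)

/-- The Parisi functional `∑ᵢ γᵢ log 2 / mᵢ + φ₀(m) - log 2`. -/
def parisi {S : Type*} [MeasurableSpace S] {n : ℕ} (μ : Fin n → Measure S)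
    (γ : Fin n → ℝ) (m : Fin n → ℝ) (φ : (Fin n → S) → ℝ) : ℝ :=
  ∑ i, γ i * Real.log 2 / m i + phiZero μ m φ - Real.log 2

end

end GREM

open InformationTheory Filter Topology
open scoped ENNReal NNReal

/-! The formula is Lagrangian duality for maximizing `∫ φ dν - H(ν | μ)` under the `n` entropy
constraints. Write `H_j` for the entropy of the first `j` coordinates. Multipliers `l_j ≥ 0` turn
the objective into `∫ φ dν - ∑ (1 / m_i) (H_i - H_{i-1})` plus constants, where `1 / m_i = 1 + ∑_{j
≥ i} l_j`; every such `m` lies in `Δ`. For fixed `m` the maximum of this expression is `φ₀(m)`, by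
the Gibbs variational principle applied one coordinate at a time (`mul_integral_phi_sub_le`, with
equality for the measure of `exists_optimal_measure`). Together with the constants this is the
Parisi functional.

The upper bound on `J*` is the Gibbs inequality combined with summation by parts
(`integral_sub_entropy_le_parisi`).

For the lower bound, multipliers are confined to a box `[0, M]ⁿ`, where Sion's theorem applies
(`exists_forall_lt_lagrangian`). It yields measures whose objective, penalized with slope `M`,
exceeds any number below the dual infimum (`exists_lt_penalized`). Near-maximizers for growing `M`
form a Cauchy sequence in total variation, because the gap in the midpoint convexity of entropy
controls that distance (`integral_abs_rnDeriv_sub_le`, `exists_penalized_cauchy`). Lower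
semicontinuity makes the limit feasible and optimal (`exists_feasible_ge`). -/

/-! ### Strong midpoint convexity of `klFun` -/

lemma two_mul_sq_sub_le_sq_mul_log {p r : ℝ} (hp : 0 ≤ p) (hr : 0 < r) :
    2 * (p ^ 2 - p * r) ≤ p ^ 2 * Real.log (p ^ 2) - p ^ 2 * Real.log (r ^ 2) := by
  rcases hp.eq_or_lt with rfl | hp
  · simp
  · have h := Real.log_le_sub_one_of_pos (div_pos hr hp)
    rw [Real.log_div hr.ne' hp.ne'] at h
    have h2 : p ^ 2 * (Real.log r - Real.log p) ≤ p ^ 2 * (r / p - 1) := by gcongr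
    have h3 : p ^ 2 * (r / p - 1) = p * r - p ^ 2 := by field_simp
    rw [Real.log_pow, Real.log_pow]
    push_cast
    nlinarith

/-- In terms of square roots of densities, the midpoint gap dominates a squared Hellinger distance.
Summing `two_mul_sq_sub_le_sq_mul_log` for `p` and `q` bounds the gap below by `2r² - r(p + q)`;
then `(p - q)² = (2r - p - q)(2r + p + q)` and `p + q ≤ 2r` conclude. -/
lemma klFun_midpoint_add_le_sq {p q r : ℝ} (hp : 0 ≤ p) (hq : 0 ≤ q) (hr : 0 ≤ r)
    (h : 2 * r ^ 2 = p ^ 2 + q ^ 2) :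
    klFun (r ^ 2) + 1 / 4 * (p - q) ^ 2 ≤ 1 / 2 * klFun (p ^ 2) + 1 / 2 * klFun (q ^ 2) := by
  rcases hr.eq_or_lt with rfl | hr
  · have hp0 : p = 0 := by nlinarith [sq_nonneg p, sq_nonneg q]
    have hq0 : q = 0 := by nlinarith [sq_nonneg p, sq_nonneg q]
    subst hp0 hq0
    simp only [klFun]
    norm_num
  · have h1 := two_mul_sq_sub_le_sq_mul_log hp hr
    have h2 := two_mul_sq_sub_le_sq_mul_log hq hr
    have h3 : p + q ≤ 2 * r := by nlinarith [sq_nonneg (p - q)]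
    have h4 : (p - q) ^ 2 ≤ 2 * (4 * r ^ 2 - 2 * r * (p + q)) := by nlinarith
    have h5 : 2 * (r ^ 2 * Real.log (r ^ 2))
        = p ^ 2 * Real.log (r ^ 2) + q ^ 2 * Real.log (r ^ 2) := by
      linear_combination Real.log (r ^ 2) * h
    simp only [klFun]
    linarith

/-- A quantitative form of the convexity of `klFun` at midpoints. -/
lemma abs_sub_le_klFun_midpoint_gap {a b η : ℝ} (ha : 0 ≤ a) (hb : 0 ≤ b) (hη : 0 < η) :
    |a - b| ≤ 2 / η * (1 / 2 * klFun a + 1 / 2 * klFun b - klFun (1 / 2 * a + 1 / 2 * b))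
      + η * (a + b) := by
  have hr : 0 ≤ 1 / 2 * a + 1 / 2 * b := by positivity
  have h := klFun_midpoint_add_le_sq (Real.sqrt_nonneg a) (Real.sqrt_nonneg b)
    (Real.sqrt_nonneg (1 / 2 * a + 1 / 2 * b))
    (by rw [Real.sq_sqrt ha, Real.sq_sqrt hb, Real.sq_sqrt hr]; ring)
  rw [Real.sq_sqrt ha, Real.sq_sqrt hb, Real.sq_sqrt hr] at h
  have hp := Real.sqrt_nonneg a
  have hq := Real.sqrt_nonneg b
  have ha2 := Real.sq_sqrt ha
  have hb2 := Real.sq_sqrt hb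
  set p := √a
  set q := √b
  have h1 : |a - b| = |p - q| * (p + q) := by
    rw [← ha2, ← hb2, show p ^ 2 - q ^ 2 = (p - q) * (p + q) by ring, abs_mul,
      abs_of_nonneg (add_nonneg hp hq)]
  -- Weighted AM-GM: the free parameter `η` trades the Hellinger term against the total mass.
  have h2 : |p - q| * (p + q) ≤ 1 / (2 * η) * (p - q) ^ 2 + η / 2 * (p + q) ^ 2 := by
    have h3 := sq_nonneg (|p - q| - η * (p + q))
    rw [← sq_abs (p - q)]
    field_simp
    nlinarith
  have h4 : η / 2 * (p + q) ^ 2 ≤ η * (a + b) := by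
    nlinarith [mul_nonneg hη.le (sq_nonneg (p - q))]
  have h5 : 1 / (2 * η) * (p - q) ^ 2
      ≤ 2 / η * (1 / 2 * klFun a + 1 / 2 * klFun b - klFun (1 / 2 * a + 1 / 2 * b)) := by
    have : 1 / (2 * η) * (p - q) ^ 2 = 2 / η * (1 / 4 * (p - q) ^ 2) := by
      field_simp; ring
    rw [this]
    gcongr
    linarith
  linarith

/-! ### Relative entropy: convexity and limits in total variation -/

section RelativeEntropy

variable {Ω Y : Type*} [MeasurableSpace Ω] [MeasurableSpace Y]

section Convexity

variable {μ ν₁ ν₂ : Measure Ω} [IsFiniteMeasure μ] [IsFiniteMeasure ν₁] [IsFiniteMeasure ν₂]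

lemma toReal_rnDeriv_combination (a b : ℝ≥0) :
    (fun x => ((a • ν₁ + b • ν₂).rnDeriv μ x).toReal) =ᵐ[μ]
      fun x => a * (ν₁.rnDeriv μ x).toReal + b * (ν₂.rnDeriv μ x).toReal := by
  filter_upwards [Measure.rnDeriv_add (a • ν₁) (b • ν₂) μ, Measure.rnDeriv_smul_left ν₁ μ a,
    Measure.rnDeriv_smul_left ν₂ μ b, Measure.rnDeriv_lt_top ν₁ μ, Measure.rnDeriv_lt_top ν₂ μ]
    with x h1 h2 h3 h4 h5
  rw [h1, Pi.add_apply, h2, h3, Pi.smul_apply, Pi.smul_apply, ENNReal.toReal_add]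
  · simp [ENNReal.smul_def]
  · exact ENNReal.mul_ne_top ENNReal.coe_ne_top h4.ne
  · exact ENNReal.mul_ne_top ENNReal.coe_ne_top h5.ne

/-- The relative entropy is convex in its first argument. -/
lemma klDiv_combination_le {a b : ℝ≥0} (hab : a + b = 1) :
    klDiv (a • ν₁ + b • ν₂) μ ≤ a * klDiv ν₁ μ + b * klDiv ν₂ μ := by
  rcases eq_or_ne a 0 with rfl | ha
  · simp only [zero_add] at hab; simp [hab]
  rcases eq_or_ne b 0 with rfl | hb
  · simp only [add_zero] at hab; simp [hab]
  by_cases h1 : ν₁ ≪ μ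
  swap; · simp [h1, ha]
  by_cases h2 : ν₂ ≪ μ
  swap; · simp [h2, hb]
  have h12 : a • ν₁ + b • ν₂ ≪ μ :=
    Measure.AbsolutelyContinuous.add_left (h1.smul_left a) (h2.smul_left b)
  rw [klDiv_eq_lintegral_klFun_of_ac h1, klDiv_eq_lintegral_klFun_of_ac h2,
    klDiv_eq_lintegral_klFun_of_ac h12, ← lintegral_const_mul _ (by fun_prop),
    ← lintegral_const_mul _ (by fun_prop), ← lintegral_add_left (by fun_prop)]
  refine lintegral_mono_ae ?_
  filter_upwards [toReal_rnDeriv_combination (μ := μ) (ν₁ := ν₁) (ν₂ := ν₂) a b] with x hx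
  rw [hx]
  have hc := convexOn_klFun.2 (x := (ν₁.rnDeriv μ x).toReal) ENNReal.toReal_nonneg
    (y := (ν₂.rnDeriv μ x).toReal) ENNReal.toReal_nonneg a.2 b.2 (by simpa using congrArg NNReal.toReal hab)
  simp only [smul_eq_mul] at hc
  have ha' : (a : ℝ≥0∞) = ENNReal.ofReal a := by simp
  have hb' : (b : ℝ≥0∞) = ENNReal.ofReal b := by simp
  rw [ha', hb', ← ENNReal.ofReal_mul a.coe_nonneg, ← ENNReal.ofReal_mul b.coe_nonneg,
    ← ENNReal.ofReal_add (mul_nonneg a.coe_nonneg (klFun_nonneg ENNReal.toReal_nonneg))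
      (mul_nonneg b.coe_nonneg (klFun_nonneg ENNReal.toReal_nonneg))]
  exact ENNReal.ofReal_le_ofReal hc

lemma klDiv_combination_ne_top {a b : ℝ≥0} (hab : a + b = 1) (h1 : klDiv ν₁ μ ≠ ∞)
    (h2 : klDiv ν₂ μ ≠ ∞) : klDiv (a • ν₁ + b • ν₂) μ ≠ ∞ :=
  ne_top_of_le_ne_top (ENNReal.add_ne_top.2 ⟨ENNReal.mul_ne_top ENNReal.coe_ne_top h1,
    ENNReal.mul_ne_top ENNReal.coe_ne_top h2⟩) (klDiv_combination_le hab)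

lemma toReal_klDiv_combination_le {a b : ℝ≥0} (hab : a + b = 1) (h1 : klDiv ν₁ μ ≠ ∞)
    (h2 : klDiv ν₂ μ ≠ ∞) :
    (klDiv (a • ν₁ + b • ν₂) μ).toReal
      ≤ a * (klDiv ν₁ μ).toReal + b * (klDiv ν₂ μ).toReal := by
  have ha := ENNReal.mul_ne_top (ENNReal.coe_ne_top (r := a)) h1
  have hb := ENNReal.mul_ne_top (ENNReal.coe_ne_top (r := b)) h2
  have h := ENNReal.toReal_mono (ENNReal.add_ne_top.2 ⟨ha, hb⟩)
    (klDiv_combination_le (μ := μ) hab)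
  rw [ENNReal.toReal_add ha hb] at h
  simpa using h

lemma integrable_klFun_rnDeriv_of_ne_top (h1 : klDiv ν₁ μ ≠ ∞) :
    Integrable (fun x => klFun (ν₁.rnDeriv μ x).toReal) μ := by
  rw [klDiv_ne_top_iff] at h1
  exact (integrable_klFun_rnDeriv_iff h1.1).2 h1.2

end Convexity

lemma integral_toReal_rnDeriv_eq_one {μ ν : Measure Ω} [IsFiniteMeasure μ]
    [IsProbabilityMeasure ν] (h : ν ≪ μ) : ∫ x, (ν.rnDeriv μ x).toReal ∂μ = 1 := by
  rw [Measure.integral_toReal_rnDeriv h]; simp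

/-- The relative entropy controls the total variation distance through its gap at midpoints. -/
lemma integral_abs_rnDeriv_sub_le {μ ν₁ ν₂ : Measure Ω} [IsFiniteMeasure μ]
    [IsProbabilityMeasure ν₁] [IsProbabilityMeasure ν₂] (h1 : klDiv ν₁ μ ≠ ∞)
    (h2 : klDiv ν₂ μ ≠ ∞) {η : ℝ} (hη : 0 < η) :
    ∫ x, |(ν₁.rnDeriv μ x).toReal - (ν₂.rnDeriv μ x).toReal| ∂μ
      ≤ 2 / η * (1 / 2 * (klDiv ν₁ μ).toReal + 1 / 2 * (klDiv ν₂ μ).toReal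
        - (klDiv ((1 / 2 : ℝ≥0) • ν₁ + (1 / 2 : ℝ≥0) • ν₂) μ).toReal) + 2 * η := by
  have h3 := klDiv_combination_ne_top (add_halves (1 : ℝ≥0)) h1 h2
  have i1 := integrable_klFun_rnDeriv_of_ne_top h1
  have i2 := integrable_klFun_rnDeriv_of_ne_top h2
  have i3 := integrable_klFun_rnDeriv_of_ne_top h3
  have a1 := (klDiv_ne_top_iff.1 h1).1
  have a2 := (klDiv_ne_top_iff.1 h2).1
  have a3 := (klDiv_ne_top_iff.1 h3).1
  have j1 : Integrable (fun x => (ν₁.rnDeriv μ x).toReal) μ := Measure.integrable_toReal_rnDeriv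
  have j2 : Integrable (fun x => (ν₂.rnDeriv μ x).toReal) μ := Measure.integrable_toReal_rnDeriv
  rw [toReal_klDiv_eq_integral_klFun a1, toReal_klDiv_eq_integral_klFun a2,
    toReal_klDiv_eq_integral_klFun a3]
  -- The pointwise bound `abs_sub_le_klFun_midpoint_gap`, integrated; `2 * η` is `η` times the
  -- masses of the two probability densities.
  have hint : ∫ x, (2 / η * (1 / 2 * klFun (ν₁.rnDeriv μ x).toReal
        + 1 / 2 * klFun (ν₂.rnDeriv μ x).toReal
        - klFun (((1 / 2 : ℝ≥0) • ν₁ + (1 / 2 : ℝ≥0) • ν₂).rnDeriv μ x).toReal)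
        + η * ((ν₁.rnDeriv μ x).toReal + (ν₂.rnDeriv μ x).toReal)) ∂μ
      = 2 / η * (1 / 2 * (∫ x, klFun (ν₁.rnDeriv μ x).toReal ∂μ)
        + 1 / 2 * (∫ x, klFun (ν₂.rnDeriv μ x).toReal ∂μ)
        - ∫ x, klFun (((1 / 2 : ℝ≥0) • ν₁ + (1 / 2 : ℝ≥0) • ν₂).rnDeriv μ x).toReal ∂μ)
        + 2 * η := by
    rw [integral_add (by fun_prop) (by fun_prop), integral_const_mul, integral_const_mul,
      integral_sub (by fun_prop) i3, integral_add (by fun_prop) (by fun_prop),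
      integral_const_mul, integral_const_mul, integral_add j1 j2,
      integral_toReal_rnDeriv_eq_one a1, integral_toReal_rnDeriv_eq_one a2]
    ring
  rw [← hint]
  refine integral_mono_ae (j1.sub j2).abs
    (((((i1.const_mul _).add (i2.const_mul _)).sub i3).const_mul _).add
      ((j1.add j2).const_mul _)) ?_
  filter_upwards [toReal_rnDeriv_combination (μ := μ) (ν₁ := ν₁) (ν₂ := ν₂) (1 / 2) (1 / 2)]
    with x hx
  rw [hx]
  have := abs_sub_le_klFun_midpoint_gap (a := (ν₁.rnDeriv μ x).toReal)
    (b := (ν₂.rnDeriv μ x).toReal) ENNReal.toReal_nonneg ENNReal.toReal_nonneg hη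
  simpa using this

lemma ae_subseq_of_tendsto_eLpNorm_one {μ : Measure Ω} [IsFiniteMeasure μ] {f : ℕ → Ω → ℝ}
    {g : Ω → ℝ} (hf : ∀ k, AEStronglyMeasurable (f k) μ) (hg : AEStronglyMeasurable g μ)
    (h : Tendsto (fun k => eLpNorm (f k - g) 1 μ) atTop (𝓝 0)) :
    ∃ ns : ℕ → ℕ, StrictMono ns ∧ ∀ᵐ x ∂μ, Tendsto (fun k => f (ns k) x) atTop (𝓝 (g x)) :=
  (tendstoInMeasure_of_tendsto_eLpNorm one_ne_zero hf hg h).exists_seq_tendsto_ae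

section Limit

variable {μ ν : Measure Ω} [IsProbabilityMeasure μ] [IsProbabilityMeasure ν]
  {νs : ℕ → Measure Ω} [∀ k, IsProbabilityMeasure (νs k)]

/-- The relative entropy is lower semicontinuous for convergence in total variation. -/
lemma klDiv_le_of_tendsto (hac : ∀ k, νs k ≪ μ) (hν : ν ≪ μ)
    (h : Tendsto (fun k => eLpNorm (fun x => ((νs k).rnDeriv μ x).toReal
      - (ν.rnDeriv μ x).toReal) 1 μ) atTop (𝓝 0)) {c : ℕ → ℝ≥0∞} {C : ℝ≥0∞}
    (hc : ∀ k, klDiv (νs k) μ ≤ c k) (hC : Tendsto c atTop (𝓝 C)) : klDiv ν μ ≤ C := by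
  -- Fatou's lemma needs almost everywhere convergence of the densities, hence a subsequence.
  obtain ⟨ns, hns, hlim⟩ := ae_subseq_of_tendsto_eLpNorm_one
    (f := fun k x => ((νs k).rnDeriv μ x).toReal) (g := fun x => (ν.rnDeriv μ x).toReal)
    (fun k => (Measure.measurable_rnDeriv _ _).ennreal_toReal.aestronglyMeasurable)
    (Measure.measurable_rnDeriv _ _).ennreal_toReal.aestronglyMeasurable h
  rw [klDiv_eq_lintegral_klFun_of_ac hν]
  calc ∫⁻ x, ENNReal.ofReal (klFun (ν.rnDeriv μ x).toReal) ∂μ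
      = ∫⁻ x, liminf (fun k => ENNReal.ofReal (klFun ((νs (ns k)).rnDeriv μ x).toReal)) atTop
          ∂μ := by
        refine lintegral_congr_ae ?_
        filter_upwards [hlim] with x hx
        exact ((ENNReal.continuous_ofReal.comp continuous_klFun).tendsto _ |>.comp
          hx).liminf_eq.symm
    _ ≤ liminf (fun k => ∫⁻ x, ENNReal.ofReal (klFun ((νs (ns k)).rnDeriv μ x).toReal) ∂μ)
          atTop := lintegral_liminf_le fun k => by fun_prop
    _ ≤ liminf (fun k => c (ns k)) atTop := by
        refine liminf_le_liminf (Eventually.of_forall fun k => ?_)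
        rw [← klDiv_eq_lintegral_klFun_of_ac (hac _)]
        exact hc _
    _ = C := (hC.comp hns.tendsto_atTop).liminf_eq

/-- Convergence in total variation passes to images. -/
lemma tendsto_eLpNorm_rnDeriv_map (hac : ∀ k, νs k ≪ μ) (hν : ν ≪ μ)
    (h : Tendsto (fun k => eLpNorm (fun x => ((νs k).rnDeriv μ x).toReal
      - (ν.rnDeriv μ x).toReal) 1 μ) atTop (𝓝 0)) {T : Ω → Y} (hT : Measurable T) :
    Tendsto (fun k => eLpNorm (fun y => (((νs k).map T).rnDeriv (μ.map T) y).toReal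
      - ((ν.map T).rnDeriv (μ.map T) y).toReal) 1 (μ.map T)) atTop (𝓝 0) := by
  refine tendsto_of_tendsto_of_tendsto_of_le_of_le tendsto_const_nhds h (fun _ => zero_le)
    fun k => ?_
  rw [eLpNorm_map_measure (by fun_prop) hT.aemeasurable]
  have hi1 : Integrable (fun x => ((νs k).rnDeriv μ x).toReal) μ :=
    Measure.integrable_toReal_rnDeriv
  have hi2 : Integrable (fun x => (ν.rnDeriv μ x).toReal) μ :=
    Measure.integrable_toReal_rnDeriv
  -- Pulled back along `T`, the density of an image measure is the conditional expectation of the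
  -- density given `T`, and conditional expectation contracts `L¹`.
  refine le_trans (le_of_eq (eLpNorm_congr_ae ?_))
    (eLpNorm_condExp_le_eLpNorm (m := MeasurableSpace.comap T inferInstance) _ le_rfl)
  filter_upwards [toReal_rnDeriv_map (hac k) hT, toReal_rnDeriv_map hν hT,
    condExp_sub hi1 hi2 (MeasurableSpace.comap T inferInstance)] with x h1 h2 h3
  have h4 : (fun x => ((νs k).rnDeriv μ x).toReal - (ν.rnDeriv μ x).toReal)
    = (fun x => ((νs k).rnDeriv μ x).toReal) - fun x => (ν.rnDeriv μ x).toReal := rfl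
  rw [h4, h3, Pi.sub_apply, ← h1, ← h2]
  rfl

/-- Taken with `T` a coordinate projection, this carries the entropy constraints on the marginals to
the limit measure. -/
lemma klDiv_map_le_of_tendsto (hac : ∀ k, νs k ≪ μ) (hν : ν ≪ μ)
    (h : Tendsto (fun k => eLpNorm (fun x => ((νs k).rnDeriv μ x).toReal
      - (ν.rnDeriv μ x).toReal) 1 μ) atTop (𝓝 0)) {T : Ω → Y} (hT : Measurable T)
    {c : ℕ → ℝ≥0∞} {C : ℝ≥0∞} (hc : ∀ k, klDiv ((νs k).map T) (μ.map T) ≤ c k)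
    (hC : Tendsto c atTop (𝓝 C)) : klDiv (ν.map T) (μ.map T) ≤ C := by
  have := Measure.isProbabilityMeasure_map (μ := μ) hT.aemeasurable
  have := Measure.isProbabilityMeasure_map (μ := ν) hT.aemeasurable
  have := fun k => Measure.isProbabilityMeasure_map (μ := νs k) hT.aemeasurable
  exact klDiv_le_of_tendsto (fun k => (hac k).map hT) (hν.map hT)
    (tendsto_eLpNorm_rnDeriv_map hac hν h hT) hc hC

lemma tendsto_integral_of_tendsto_eLpNorm (hac : ∀ k, νs k ≪ μ) (hν : ν ≪ μ)
    (h : Tendsto (fun k => eLpNorm (fun x => ((νs k).rnDeriv μ x).toReal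
      - (ν.rnDeriv μ x).toReal) 1 μ) atTop (𝓝 0)) {φ : Ω → ℝ} (hφ : Measurable φ) {B : ℝ}
    (hB : ∀ x, |φ x| ≤ B) :
    Tendsto (fun k => ∫ x, φ x ∂(νs k)) atTop (𝓝 (∫ x, φ x ∂ν)) := by
  have hi : ∀ ρ : Measure Ω, IsProbabilityMeasure ρ →
      Integrable (fun x => (ρ.rnDeriv μ x).toReal * φ x) μ := fun ρ _ =>
    Measure.integrable_toReal_rnDeriv.mul_bdd hφ.aestronglyMeasurable
      (Eventually.of_forall fun x => by simpa using hB x)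
  have hr : ∀ ρ : Measure Ω, IsProbabilityMeasure ρ → ρ ≪ μ →
      ∫ x, φ x ∂ρ = ∫ x, (ρ.rnDeriv μ x).toReal * φ x ∂μ := fun ρ _ hρ => by
    rw [← integral_rnDeriv_smul hρ]; rfl
  rw [hr ν inferInstance hν]
  simp_rw [hr (νs _) inferInstance (hac _)]
  refine tendsto_integral_of_L1' _ (hi ν inferInstance).1
    (Eventually.of_forall fun k => hi _ inferInstance) ?_
  have hlim : Tendsto (fun k => ENNReal.ofReal B * eLpNorm (fun x => ((νs k).rnDeriv μ x).toReal
      - (ν.rnDeriv μ x).toReal) 1 μ) atTop (𝓝 0) := by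
    simpa using ENNReal.Tendsto.const_mul h (Or.inr ENNReal.ofReal_ne_top)
  refine tendsto_of_tendsto_of_tendsto_of_le_of_le tendsto_const_nhds hlim (fun _ => zero_le)
    fun k => ?_
  refine eLpNorm_le_mul_eLpNorm_of_ae_le_mul (Eventually.of_forall fun x => ?_) 1
  simp only [Pi.sub_apply, ← sub_mul, norm_mul]
  rw [mul_comm]
  gcongr
  exact hB x

/-- Completeness of the probability measures dominated by `μ` in total variation. -/
lemma exists_tendsto_eLpNorm_rnDeriv (hac : ∀ k, νs k ≪ μ)
    (h : ∀ ε > 0, ∃ N, ∀ k ≥ N, ∀ l ≥ N, ∫ x, |((νs k).rnDeriv μ x).toReal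
      - ((νs l).rnDeriv μ x).toReal| ∂μ < ε) :
    ∃ ρ : Measure Ω, IsProbabilityMeasure ρ ∧ ρ ≪ μ ∧
      Tendsto (fun k => eLpNorm (fun x => ((νs k).rnDeriv μ x).toReal
        - (ρ.rnDeriv μ x).toReal) 1 μ) atTop (𝓝 0) := by
  have hi : ∀ k, Integrable (fun x => ((νs k).rnDeriv μ x).toReal) μ :=
    fun k => Measure.integrable_toReal_rnDeriv
  have hcau : CauchySeq fun k => (hi k).toL1 _ := by
    refine Metric.cauchySeq_iff.2 fun ε hε => ?_
    obtain ⟨N, hN⟩ := h ε hε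
    refine ⟨N, fun k hk l hl => ?_⟩
    rw [dist_eq_norm, ← Integrable.toL1_sub, L1.norm_of_fun_eq_integral_norm]
    exact hN k hk l hl
  obtain ⟨g, hg⟩ := cauchySeq_tendsto_of_complete hcau
  have hg' : Tendsto (fun k => eLpNorm ((fun x => ((νs k).rnDeriv μ x).toReal)
      - (g : Ω → ℝ)) 1 μ) atTop
      (𝓝 0) := by
    have := (Lp.tendsto_Lp_iff_tendsto_eLpNorm' _ _).1 hg
    refine this.congr fun k => eLpNorm_congr_ae ?_
    filter_upwards [(hi k).coeFn_toL1] with x hx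
    rw [Pi.sub_apply, Pi.sub_apply, hx]
  have hgi : Integrable g μ := L1.integrable_coeFn g
  -- The `L¹` limit is a probability density: nonnegativity passes along an almost everywhere
  -- convergent subsequence, total mass by convergence of integrals.
  have hg0 : 0 ≤ᵐ[μ] g := by
    obtain ⟨ns, -, hlim⟩ := ae_subseq_of_tendsto_eLpNorm_one (fun k => (hi k).1) hgi.1 hg'
    filter_upwards [hlim] with x hx
    exact ge_of_tendsto' hx fun k => ENNReal.toReal_nonneg
  have hg1 : ∫ x, g x ∂μ = 1 := by
    refine tendsto_nhds_unique (tendsto_integral_of_L1' _ hgi.1 (Eventually.of_forall hi) hg') ?_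
    simp_rw [integral_toReal_rnDeriv_eq_one (hac _)]
    exact tendsto_const_nhds
  have hgm : AEMeasurable (fun x => ENNReal.ofReal (g x)) μ := hgi.1.aemeasurable.ennreal_ofReal
  refine ⟨μ.withDensity fun x => ENNReal.ofReal (g x), ⟨?_⟩,
    withDensity_absolutelyContinuous _ _, ?_⟩
  · rw [withDensity_apply _ MeasurableSet.univ, setLIntegral_univ,
      ← ofReal_integral_eq_lintegral_ofReal hgi hg0, hg1, ENNReal.ofReal_one]
  · refine hg'.congr fun k => eLpNorm_congr_ae ?_
    filter_upwards [Measure.rnDeriv_withDensity₀ μ hgm, hg0] with x hx hx0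
    rw [Pi.sub_apply, hx, ENNReal.toReal_ofReal hx0]

end Limit

end RelativeEntropy

/-! ### Tilted measures and change of reference measure -/

lemma integrable_exp_of_abs_le {Z : Type*} [MeasurableSpace Z] {κ : Measure Z} [IsFiniteMeasure κ]
    {G : Z → ℝ} (hG : Measurable G) {C : ℝ} (hC : ∀ z, |G z| ≤ C) :
    Integrable (fun z => Real.exp (G z)) κ :=
  Integrable.of_bound hG.exp.aestronglyMeasurable (Real.exp C)
    (Eventually.of_forall fun z => by
      rw [Real.norm_eq_abs, Real.abs_exp]
      exact Real.exp_le_exp.2 ((le_abs_self _).trans (hC z)))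

lemma integrable_of_abs_le {Z : Type*} [MeasurableSpace Z] {κ : Measure Z} [IsFiniteMeasure κ]
    {G : Z → ℝ} (hG : Measurable G) {C : ℝ} (hC : ∀ z, |G z| ≤ C) : Integrable G κ :=
  Integrable.of_bound hG.aestronglyMeasurable C (Eventually.of_forall hC)

section Tilting

variable {X E Z : Type*} [MeasurableSpace X] [MeasurableSpace E] [MeasurableSpace Z]

/-- Tilting the last factor of a product by a family of conditional densities does not change
the first marginal. -/
lemma map_tilted_map_prod {A : Measure X} [IsProbabilityMeasure A] {B : Measure E}
    [IsProbabilityMeasure B] {s : X × E → Z} (hs : Measurable s) {r : Z → X} (hr : Measurable r)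
    (hrs : ∀ p, r (s p) = p.1) {G : Z → ℝ} (hG : Measurable G) {C : ℝ} (hC : ∀ z, |G z| ≤ C)
    (h : ∀ x, ∫ y, Real.exp (G (s (x, y))) ∂B = 1) :
    ∫ z, Real.exp (G z) ∂((A.prod B).map s) = 1 ∧ (((A.prod B).map s).tilted G).map r = A := by
  have hint : ∫ z, Real.exp (G z) ∂((A.prod B).map s) = 1 := by
    rw [integral_map hs.aemeasurable hG.exp.aestronglyMeasurable,
      integral_prod _ (integrable_exp_of_abs_le (G := fun p => G (s p)) (by fun_prop)
        fun p => hC (s p))]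
    simp [h]
  refine ⟨hint, ?_⟩
  ext a ha
  have hm : Measurable fun z => ENNReal.ofReal (Real.exp (G z)) := hG.exp.ennreal_ofReal
  rw [Measure.map_apply hr ha, tilted_apply' _ _ (hr ha), hint]
  simp only [div_one]
  have hm' : Measurable ((s ⁻¹' (r ⁻¹' a)).indicator
      fun p => ENNReal.ofReal (Real.exp (G (s p)))) := (hm.comp hs).indicator (hs (hr ha))
  rw [setLIntegral_map (hr ha) hm hs, ← lintegral_indicator (hs (hr ha)),
    lintegral_prod _ hm'.aemeasurable]
  have : ∀ x, ∫⁻ y, (s ⁻¹' (r ⁻¹' a)).indicator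
      (fun p => ENNReal.ofReal (Real.exp (G (s p)))) (x, y) ∂B = a.indicator 1 x := by
    intro x
    by_cases hx : x ∈ a
    · have : ∀ y, (s ⁻¹' (r ⁻¹' a)).indicator
          (fun p => ENNReal.ofReal (Real.exp (G (s p)))) (x, y)
            = ENNReal.ofReal (Real.exp (G (s (x, y)))) := fun y =>
        Set.indicator_of_mem (by simpa [hrs] using hx) _
      simp_rw [this]
      rw [← ofReal_integral_eq_lintegral_ofReal _ (Eventually.of_forall fun y => by positivity),
        h x]
      · simp [hx]
      · exact integrable_exp_of_abs_le (G := fun y => G (s (x, y))) (by fun_prop)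
          fun y => hC (s (x, y))
    · have : ∀ y, (s ⁻¹' (r ⁻¹' a)).indicator
          (fun p => ENNReal.ofReal (Real.exp (G (s p)))) (x, y) = 0 := fun y =>
        Set.indicator_of_notMem (by simpa [hrs] using hx) _
      simp [this, hx]
  simp_rw [this]
  rw [lintegral_indicator_one ha]

/-- A change of reference measure followed by the data processing inequality. -/
lemma integral_add_toReal_klDiv_map_le {ρ κ : Measure Z} [IsProbabilityMeasure ρ]
    [IsProbabilityMeasure κ] {A : Measure X} {r : Z → X} (hr : Measurable r) {G : Z → ℝ}
    (hG : Measurable G) {C : ℝ} (hC : ∀ z, |G z| ≤ C) (hint : ∫ z, Real.exp (G z) ∂κ = 1)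
    (hA : (κ.tilted G).map r = A) (hfin : klDiv ρ κ ≠ ∞) :
    ∫ z, G z ∂ρ + (klDiv (ρ.map r) A).toReal ≤ (klDiv ρ κ).toReal := by
  obtain ⟨hac, hi⟩ := klDiv_ne_top_iff.1 hfin
  have hexp : Integrable (fun z => Real.exp (G z)) κ := integrable_exp_of_abs_le hG hC
  have hGρ : Integrable G ρ := integrable_of_abs_le hG hC
  have := isProbabilityMeasure_tilted hexp
  have hac' : ρ ≪ κ.tilted G := hac.trans (absolutelyContinuous_tilted hexp)
  have hi' := integrable_llr_tilted_right hac hGρ hi hexp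
  -- Since `exp G` has integral one, no normalizing constant appears when `κ` is replaced by its
  -- tilt.
  have h1 : (klDiv ρ (κ.tilted G)).toReal = (klDiv ρ κ).toReal - ∫ z, G z ∂ρ := by
    rw [toReal_klDiv_of_measure_eq hac' (by simp), toReal_klDiv_of_measure_eq hac (by simp),
      integral_llr_tilted_right hac hGρ hexp hi, hint, Real.log_one, add_zero]
  have h2 := ENNReal.toReal_mono (klDiv_ne_top hac' hi')
    (klDiv_map_le ρ (κ.tilted G) hr)
  rw [hA, h1] at h2
  linarith

/-- The relative entropy of a measure of the form `κ.tilted G` with `∫ exp G ∂κ = 1`. -/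
lemma klDiv_tilted_self {κ : Measure Z} [IsProbabilityMeasure κ] {G : Z → ℝ}
    (hG : Measurable G) {C : ℝ} (hC : ∀ z, |G z| ≤ C) (hint : ∫ z, Real.exp (G z) ∂κ = 1) :
    klDiv (κ.tilted G) κ ≠ ∞ ∧ (klDiv (κ.tilted G) κ).toReal = ∫ z, G z ∂(κ.tilted G) := by
  have hexp : Integrable (fun z => Real.exp (G z)) κ := integrable_exp_of_abs_le hG hC
  have := isProbabilityMeasure_tilted hexp
  have hac := tilted_absolutelyContinuous κ G
  have hlog : llr (κ.tilted G) κ =ᵐ[κ.tilted G] G := by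
    refine hac.ae_le ?_
    filter_upwards [log_rnDeriv_tilted_left_self hexp] with z hz
    rw [llr, hz, hint, Real.log_one, sub_zero]
  refine ⟨klDiv_ne_top hac ?_, ?_⟩
  · rw [integrable_congr hlog]
    exact integrable_of_abs_le hG hC
  · rw [toReal_klDiv_of_measure_eq hac (by simp), integral_congr_ae hlog]

end Tilting

/-! ### Marginals of measures on `Sⁿ` -/

namespace GREM

variable {S : Type*} [MeasurableSpace S] {n : ℕ}

lemma measurable_take (j : Fin (n + 1)) :
    Measurable fun x : Fin n → S => Fin.take j j.is_le x :=
  measurable_pi_iff.2 fun _ => measurable_pi_apply _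

lemma measurable_snoc (k : ℕ) :
    Measurable fun p : (Fin k → S) × S => (Fin.snoc (α := fun _ => S) p.1 p.2 : Fin (k + 1) → S) := by
  refine measurable_pi_iff.2 fun l => ?_
  refine Fin.lastCases ?_ (fun l => ?_) l
  · simpa using measurable_snd
  · simp only [Fin.snoc_castSucc]
    fun_prop

lemma measurable_init (k : ℕ) :
    Measurable fun x : Fin (k + 1) → S => (Fin.init (α := fun _ => S) x : Fin k → S) :=
  measurable_pi_iff.2 fun _ => measurable_pi_apply _

instance (ν : Measure (Fin n → S)) [IsProbabilityMeasure ν] (j : Fin (n + 1)) :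
    IsProbabilityMeasure (marginal ν j) :=
  Measure.isProbabilityMeasure_map (measurable_take j).aemeasurable

lemma marginal_last (ν : Measure (Fin n → S)) : marginal ν (Fin.last n) = ν :=
  Measure.map_id

lemma map_init_marginal (ν : Measure (Fin n → S)) (i : Fin n) :
    (marginal ν i.succ).map (fun x : Fin (i + 1) → S => (Fin.init (α := fun _ => S) x : Fin i → S))
      = marginal ν i.castSucc :=
  Measure.map_map (measurable_init i) (measurable_take i.succ)

lemma marginal_zero (ν ν' : Measure (Fin n → S)) [IsProbabilityMeasure ν]
    [IsProbabilityMeasure ν'] : marginal ν 0 = marginal ν' 0 := by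
  have : Subsingleton (Fin (0 : Fin (n + 1)) → S) :=
    ⟨fun a b => funext fun k => (Nat.not_lt_zero _ k.2).elim⟩
  ext a _
  rcases Set.eq_empty_or_nonempty a with rfl | ha
  · rw [measure_empty, measure_empty]
  · rw [Subsingleton.eq_univ_of_nonempty ha, measure_univ, measure_univ]

variable (μ : Fin n → Measure S) [∀ i, IsProbabilityMeasure (μ i)]

instance : IsProbabilityMeasure (prodMeasure μ) := by
  unfold prodMeasure; infer_instance

lemma marginal_prodMeasure (j : Fin (n + 1)) :
    marginal (prodMeasure μ) j = Measure.pi fun k : Fin j => μ (Fin.castLE j.is_le k) := by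
  refine (Measure.pi_eq fun s hs => ?_).symm
  rw [marginal, Measure.map_apply (measurable_take j) (MeasurableSet.univ_pi hs)]
  have : (fun x : Fin n → S => Fin.take j j.is_le x) ⁻¹' Set.univ.pi s
      = Set.univ.pi fun k : Fin n => if h : (k : ℕ) < j then s ⟨k, h⟩ else Set.univ := by
    ext x
    simp only [Set.mem_preimage, Set.mem_univ_pi]
    constructor
    · intro hx k
      split_ifs with h
      · exact hx ⟨k, h⟩
      · trivial
    · intro hx k
      simpa using hx (Fin.castLE j.is_le k)
  rw [this, prodMeasure, Measure.pi_pi]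
  symm
  refine Finset.prod_of_injOn (Fin.castLE j.is_le) (Fin.castLE_injective _).injOn (by simp)
    (fun k _ hk => ?_) (fun k _ => by simp)
  have : ¬ (k : ℕ) < j := fun h => hk ⟨⟨k, h⟩, by simp, by ext; simp⟩
  simp [this]

lemma marginal_prodMeasure_succ (i : Fin n) :
    marginal (prodMeasure μ) i.succ = ((marginal (prodMeasure μ) i.castSucc).prod (μ i)).map
      fun p : (Fin i → S) × S => (Fin.snoc (α := fun _ => S) p.1 p.2 : Fin (i + 1) → S) := by
  rw [marginal_prodMeasure, marginal_prodMeasure]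
  refine Measure.pi_eq (ι := Fin (i + 1)) fun s hs => ?_
  rw [Measure.map_apply (measurable_snoc i) (MeasurableSet.univ_pi hs)]
  have : (fun p : (Fin i → S) × S => (Fin.snoc (α := fun _ => S) p.1 p.2 : Fin (i + 1) → S)) ⁻¹'
      Set.univ.pi s = (Set.univ.pi fun k : Fin i => s k.castSucc) ×ˢ s (Fin.last i) := by
    ext p
    simp only [Set.mem_preimage, Set.mem_univ_pi, Set.mem_prod]
    constructor
    · exact fun h => ⟨fun k => by simpa using h k.castSucc, by simpa using h (Fin.last i)⟩
    · rintro ⟨h1, h2⟩ k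
      refine Fin.lastCases ?_ (fun k => ?_) k
      · simpa using h2
      · simpa using h1 k
  rw [this, Measure.prod_prod, Measure.pi_pi, Fin.prod_univ_castSucc]
  rfl

end GREM

/-! ### Telescoping and summation by parts on `Fin n` -/

section Sums

lemma Fin.sum_succ_sub_castSucc {n : ℕ} (a : Fin (n + 1) → ℝ) :
    ∑ i : Fin n, (a i.succ - a i.castSucc) = a (Fin.last n) - a 0 := by
  have h1 := Fin.sum_univ_succ a
  have h2 := Fin.sum_univ_castSucc a
  rw [Finset.sum_sub_distrib]
  linarith

lemma Fin.sum_Iic_last {n : ℕ} (d : Fin (n + 1) → ℝ) :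
    ∑ k ∈ Finset.Iic (Fin.last n), d k = ∑ k, d k := by
  rw [← Fin.top_eq_last, Finset.Iic_top]

lemma Fin.sum_Iic_succ_sub_castSucc {n : ℕ} (a : Fin (n + 1) → ℝ) (j : Fin n) :
    ∑ i ∈ Finset.Iic j, (a i.succ - a i.castSucc) = a j.succ - a 0 := by
  induction n with
  | zero => exact j.elim0
  | succ n ih =>
    refine Fin.lastCases ?_ (fun j => ?_) j
    · rw [Fin.sum_Iic_last, Fin.sum_succ_sub_castSucc, Fin.succ_last]
    · rw [Fin.sum_Iic_castSucc]
      exact ih (fun i => a i.castSucc) j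

/-- Summation by parts with antitone nonnegative weights. -/
lemma Fin.sum_mul_nonneg_of_antitone {n : ℕ} {c d : Fin n → ℝ} (hc : Antitone c)
    (hc0 : ∀ i, 0 ≤ c i) (hd : ∀ j, 0 ≤ ∑ k ∈ Finset.Iic j, d k) : 0 ≤ ∑ i, c i * d i := by
  induction n with
  | zero => simp
  | succ n ih =>
    -- Subtracting the last weight keeps the others nonnegative and antitone; what was removed is
    -- the last weight times the full sum of `d`.
    have h1 := ih (c := fun i => c i.castSucc - c (Fin.last n)) (d := fun i => d i.castSucc)
      (fun i j hij => sub_le_sub_right (hc (Fin.castSucc_le_castSucc_iff.2 hij)) _)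
      (fun i => sub_nonneg.2 (hc (Fin.le_last _)))
      (fun j => by rw [← Fin.sum_Iic_castSucc]; exact hd _)
    have h2 := mul_nonneg (hc0 (Fin.last n)) (hd (Fin.last n))
    rw [Fin.sum_Iic_last] at h2
    have h3 : ∑ i, c i * d i = ∑ i : Fin n, (c i.castSucc - c (Fin.last n)) * d i.castSucc
        + c (Fin.last n) * ∑ k, d k := by
      rw [Fin.sum_univ_castSucc, Fin.sum_univ_castSucc, mul_add, Finset.mul_sum,
        ← add_assoc, ← Finset.sum_add_distrib]
      congr 1
      exact Finset.sum_congr rfl fun i _ => by ring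
    rw [h3]
    exact add_nonneg h1 h2

end Sums

/-! ### The Gibbs variational principle, one coordinate at a time -/

namespace GREM

variable {S : Type*} [MeasurableSpace S] {n : ℕ} (μ : Fin n → Measure S)

lemma integral_marginal_castSucc (ν : Measure (Fin n → S)) (i : Fin n) {g : (Fin i → S) → ℝ}
    (hg : Measurable g) : ∫ z, g z ∂(marginal ν i.castSucc)
      = ∫ z : Fin i.succ → S, g (Fin.init (n := i) (α := fun _ => S) z) ∂(marginal ν i.succ) := by
  rw [← map_init_marginal]
  exact integral_map (measurable_init i).aemeasurable hg.aestronglyMeasurable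

/-- The relative entropy of the marginals on the first `j` coordinates. -/
noncomputable def entropy (ν : Measure (Fin n → S)) (j : Fin (n + 1)) : ℝ :=
  (klDiv (marginal ν j) (marginal (prodMeasure μ) j)).toReal

lemma entropy_last (ν : Measure (Fin n → S)) : entropy μ ν (Fin.last n) = (klDiv ν (prodMeasure μ)).toReal := by
  rw [entropy, marginal_last, marginal_last]

lemma integral_phi_zero (m : Fin n → ℝ) (φ : (Fin n → S) → ℝ) (ν : Measure (Fin n → S))
    [IsProbabilityMeasure ν] :
    ∫ z, phi μ m φ 0 z ∂(marginal ν 0) = phiZero μ m φ := by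
  have : ∀ z, phi μ m φ 0 z = phiZero μ m φ := fun z =>
    congrArg (phi μ m φ 0) (funext fun k => (Nat.not_lt_zero _ k.2).elim)
  simp_rw [this]
  rw [integral_const, probReal_univ, one_smul]

/-- The logarithm of the conditional density of the coordinate `i` given the previous ones under
the optimal measure. -/
noncomputable def logDensity (m : Fin n → ℝ) (φ : (Fin n → S) → ℝ) (i : Fin n)
    (z : Fin (i + 1) → S) : ℝ :=
  m i * (phi μ m φ i.succ z - phi μ m φ i.castSucc (Fin.init (α := fun _ => S) z))

/-- The logarithm of the density of the optimal measure on the first `j` coordinates. -/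
noncomputable def sumLogDensity (m : Fin n → ℝ) (φ : (Fin n → S) → ℝ) :
    (j : Fin (n + 1)) → (Fin j → S) → ℝ :=
  Fin.induction (motive := fun j : Fin (n + 1) => (Fin j → S) → ℝ) (fun _ => 0)
    fun (i : Fin n) (f : (Fin i → S) → ℝ) (z : Fin (i + 1) → S) =>
      f (Fin.init (α := fun _ => S) z) + logDensity μ m φ i z

lemma sumLogDensity_zero (m : Fin n → ℝ) (φ : (Fin n → S) → ℝ) (z : Fin (0 : Fin (n + 1)) → S) :
    sumLogDensity μ m φ 0 z = 0 := rfl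

lemma sumLogDensity_succ (m : Fin n → ℝ) (φ : (Fin n → S) → ℝ) (i : Fin n) (z : Fin (i + 1) → S) :
    sumLogDensity μ m φ i.succ z = sumLogDensity μ m φ i.castSucc (Fin.init (α := fun _ => S) z)
      + logDensity μ m φ i z := by
  simp only [sumLogDensity, Fin.induction_succ]

section Phi

variable [∀ i, IsProbabilityMeasure (μ i)] {m : Fin n → ℝ} {φ : (Fin n → S) → ℝ} {B : ℝ}

/-- Each step of the recursion is an exponential mean under a probability measure, so it cannot
leave `[-B, B]`. -/
lemma measurable_phi_and_abs_le (hm : ∀ i, 0 < m i) (hφ : Measurable φ) (hB : ∀ x, |φ x| ≤ B)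
    (j : Fin (n + 1)) : Measurable (phi μ m φ j) ∧ ∀ x, |phi μ m φ j x| ≤ B := by
  induction j using Fin.reverseInduction with
  | last => rw [phi_last]; exact ⟨hφ, hB⟩
  | cast i ih =>
    obtain ⟨ih1, ih2⟩ := ih
    have hmeas : Measurable fun p : (Fin i → S) × S =>
        Real.exp (m i * phi μ m φ i.succ (Fin.snoc (α := fun _ => S) p.1 p.2)) :=
      ((ih1.comp (measurable_snoc i)).const_mul _).exp
    constructor
    · have : phi μ m φ i.castSucc = fun x => 1 / m i * Real.log (∫ y,
          Real.exp (m i * phi μ m φ i.succ (Fin.snoc (α := fun _ => S) x y)) ∂(μ i)) :=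
        funext fun x => phi_castSucc μ m φ i x
      rw [this]
      exact (hmeas.stronglyMeasurable.integral_prod_right (ν := μ i)).measurable.log.const_mul _
    · intro x
      rw [phi_castSucc]
      have hbd : ∀ y, |m i * phi μ m φ i.succ (Fin.snoc (α := fun _ => S) x y)| ≤ m i * B := by
        intro y
        rw [abs_mul, abs_of_pos (hm i)]
        exact mul_le_mul_of_nonneg_left (ih2 _) (hm i).le
      have hint : Integrable (fun y =>
          Real.exp (m i * phi μ m φ i.succ (Fin.snoc (α := fun _ => S) x y))) (μ i) :=
        Integrable.of_bound (hmeas.comp measurable_prodMk_left).aestronglyMeasurable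
          (Real.exp (m i * B)) (Eventually.of_forall fun y => by
            rw [Real.norm_eq_abs, Real.abs_exp]
            exact Real.exp_le_exp.2 (abs_le.1 (hbd y)).2)
      have hlow := integral_mono (integrable_const (Real.exp (-(m i * B)))) hint
        fun y => Real.exp_le_exp.2 (abs_le.1 (hbd y)).1
      have hup := integral_mono hint (integrable_const (Real.exp (m i * B)))
        fun y => Real.exp_le_exp.2 (abs_le.1 (hbd y)).2
      simp only [integral_const, probReal_univ, one_smul] at hlow hup
      have hpos := (Real.exp_pos _).trans_le hlow
      have h1 := (Real.le_log_iff_exp_le hpos).2 hlow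
      have h2 := (Real.log_le_iff_le_exp hpos).2 hup
      rw [abs_mul, abs_of_pos (one_div_pos.2 (hm i)), one_div, inv_mul_le_iff₀ (hm i)]
      exact abs_le.2 ⟨h1, h2⟩

lemma measurable_logDensity (hm : ∀ i, 0 < m i) (hφ : Measurable φ) (hB : ∀ x, |φ x| ≤ B)
    (i : Fin n) : Measurable (logDensity μ m φ i) :=
  ((measurable_phi_and_abs_le μ hm hφ hB i.succ).1.sub
    ((measurable_phi_and_abs_le μ hm hφ hB i.castSucc).1.comp (measurable_init i))).const_mul _

lemma abs_logDensity_le (hm : ∀ i, 0 < m i) (hφ : Measurable φ) (hB : ∀ x, |φ x| ≤ B)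
    (i : Fin n) (z : Fin (i + 1) → S) : |logDensity μ m φ i z| ≤ m i * (B + B) := by
  rw [logDensity, abs_mul, abs_of_pos (hm i)]
  refine mul_le_mul_of_nonneg_left ((abs_sub _ _).trans (add_le_add ?_ ?_)) (hm i).le
  · exact (measurable_phi_and_abs_le μ hm hφ hB i.succ).2 _
  · exact (measurable_phi_and_abs_le μ hm hφ hB i.castSucc).2 _

/-- The recursion for `phi` is exactly the normalization that makes `exp (logDensity)` a conditional
probability density. -/
lemma integral_exp_logDensity_snoc (hm : ∀ i, 0 < m i) (hφ : Measurable φ)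
    (hB : ∀ x, |φ x| ≤ B) (i : Fin n) (x : Fin i → S) :
    ∫ y, Real.exp (logDensity μ m φ i (Fin.snoc (α := fun _ => S) x y)) ∂(μ i) = 1 := by
  have hsucc := measurable_phi_and_abs_le μ hm hφ hB i.succ
  have hint : Integrable (fun y =>
      Real.exp (m i * phi μ m φ i.succ (Fin.snoc (α := fun _ => S) x y))) (μ i) := by
    refine integrable_exp_of_abs_le (C := m i * B) ((hsucc.1.comp
      ((measurable_snoc i).comp measurable_prodMk_left)).const_mul _) fun y => ?_
    rw [abs_mul, abs_of_pos (hm i)]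
    exact mul_le_mul_of_nonneg_left (hsucc.2 _) (hm i).le
  have hpos := integral_exp_pos hint
  have h : ∀ y, Real.exp (logDensity μ m φ i (Fin.snoc (α := fun _ => S) x y))
      = Real.exp (m i * phi μ m φ i.succ (Fin.snoc (α := fun _ => S) x y))
        * (∫ y, Real.exp (m i * phi μ m φ i.succ (Fin.snoc (α := fun _ => S) x y)) ∂(μ i))⁻¹ := by
    intro y
    rw [logDensity, Fin.init_snoc, mul_sub, Real.exp_sub, phi_castSucc, ← mul_assoc,
      mul_one_div_cancel (hm i).ne', one_mul, Real.exp_log hpos, div_eq_mul_inv]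
  simp_rw [h]
  rw [integral_mul_const, mul_inv_cancel₀ hpos.ne']

lemma tilted_logDensity (hm : ∀ i, 0 < m i) (hφ : Measurable φ) (hB : ∀ x, |φ x| ≤ B)
    (i : Fin n) :
    ∫ z, Real.exp (logDensity μ m φ i z) ∂(marginal (prodMeasure μ) i.succ) = 1 ∧
      ((marginal (prodMeasure μ) i.succ).tilted (logDensity μ m φ i)).map
        (fun z : Fin (i + 1) → S => (Fin.init (α := fun _ => S) z : Fin i → S))
        = marginal (prodMeasure μ) i.castSucc := by
  rw [marginal_prodMeasure_succ]
  exact map_tilted_map_prod (measurable_snoc i) (measurable_init i)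
    (fun p => Fin.init_snoc (α := fun _ => S) p.2 p.1)
    (measurable_logDensity μ hm hφ hB i) (abs_logDensity_le μ hm hφ hB i)
    (integral_exp_logDensity_snoc μ hm hφ hB i)

end Phi

variable [∀ i, IsProbabilityMeasure (μ i)] {m : Fin n → ℝ} {φ : (Fin n → S) → ℝ} {B : ℝ}
  {ν : Measure (Fin n → S)} [IsProbabilityMeasure ν]

lemma klDiv_marginal_ne_top (hν : klDiv ν (prodMeasure μ) ≠ ∞) (j : Fin (n + 1)) :
    klDiv (marginal ν j) (marginal (prodMeasure μ) j) ≠ ∞ :=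
  ne_top_of_le_ne_top hν (klDiv_map_le ν (prodMeasure μ) (measurable_take j))

lemma entropy_zero : entropy μ ν 0 = 0 := by
  rw [entropy, marginal_zero ν (prodMeasure μ), klDiv_self, ENNReal.toReal_zero]

lemma integral_logDensity (hm : ∀ i, 0 < m i) (hφ : Measurable φ) (hB : ∀ x, |φ x| ≤ B)
    (i : Fin n) : ∫ z, logDensity μ m φ i z ∂(marginal ν i.succ)
      = m i * (∫ z, phi μ m φ i.succ z ∂(marginal ν i.succ)
        - ∫ z, phi μ m φ i.castSucc z ∂(marginal ν i.castSucc)) := by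
  have h1 := measurable_phi_and_abs_le μ hm hφ hB i.succ
  have h2 := measurable_phi_and_abs_le μ hm hφ hB i.castSucc
  have h3 : Measurable fun z : Fin (i + 1) → S =>
      phi μ m φ i.castSucc (Fin.init (α := fun _ => S) z) := h2.1.comp (measurable_init i)
  rw [integral_marginal_castSucc ν i h2.1]
  unfold logDensity
  rw [integral_const_mul, integral_sub (integrable_of_abs_le h1.1 h1.2)
    (integrable_of_abs_le h3 fun z => h2.2 _)]

/-- The Gibbs variational inequality for one coordinate. -/
lemma mul_integral_phi_sub_le (hm : ∀ i, 0 < m i) (hφ : Measurable φ) (hB : ∀ x, |φ x| ≤ B)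
    (hν : klDiv ν (prodMeasure μ) ≠ ∞) (i : Fin n) :
    m i * (∫ z, phi μ m φ i.succ z ∂(marginal ν i.succ)
        - ∫ z, phi μ m φ i.castSucc z ∂(marginal ν i.castSucc))
      ≤ entropy μ ν i.succ - entropy μ ν i.castSucc := by
  obtain ⟨h1, h2⟩ := tilted_logDensity μ hm hφ hB i
  have h := integral_add_toReal_klDiv_map_le (ρ := marginal ν i.succ) (measurable_init i)
    (measurable_logDensity μ hm hφ hB i) (abs_logDensity_le μ hm hφ hB i) h1 h2
    (klDiv_marginal_ne_top μ hν i.succ)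
  rw [integral_logDensity μ hm hφ hB, map_init_marginal] at h
  unfold entropy
  linarith

lemma measurable_sumLogDensity (hm : ∀ i, 0 < m i) (hφ : Measurable φ) (hB : ∀ x, |φ x| ≤ B)
    (j : Fin (n + 1)) : Measurable (sumLogDensity μ m φ j) ∧
      ∃ C, ∀ z, |sumLogDensity μ m φ j z| ≤ C := by
  induction j using Fin.induction with
  | zero =>
    exact ⟨by rw [funext (sumLogDensity_zero μ m φ)]; exact measurable_const, 0, fun z => by rw [sumLogDensity_zero, abs_zero]⟩
  | succ i ih =>
    obtain ⟨h1, C, h2⟩ := ih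
    have : sumLogDensity μ m φ i.succ = fun z : Fin (i + 1) → S =>
        sumLogDensity μ m φ i.castSucc (Fin.init (α := fun _ => S) z) + logDensity μ m φ i z :=
      funext fun z => sumLogDensity_succ μ m φ i z
    rw [this]
    exact ⟨(h1.comp (measurable_init i)).add (measurable_logDensity μ hm hφ hB i),
      C + m i * (B + B), fun z => (abs_add_le _ _).trans
        (add_le_add (h2 _) (abs_logDensity_le μ hm hφ hB i z))⟩

/-- By `tilted_logDensity`, weighting by the last conditional density and forgetting the last
coordinate gives back the previous product marginal, so the normalization is inductive. -/
lemma integral_exp_sumLogDensity (hm : ∀ i, 0 < m i) (hφ : Measurable φ)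
    (hB : ∀ x, |φ x| ≤ B) (j : Fin (n + 1)) :
    ∫ z, Real.exp (sumLogDensity μ m φ j z) ∂(marginal (prodMeasure μ) j) = 1 := by
  induction j using Fin.induction with
  | zero =>
    simp_rw [sumLogDensity_zero]
    rw [integral_const, probReal_univ, one_smul, Real.exp_zero]
  | succ i ih =>
    obtain ⟨h1, h2⟩ := tilted_logDensity μ hm hφ hB i
    have h3 := (measurable_sumLogDensity μ hm hφ hB i.castSucc).1
    have h4 : ∫ z, Real.exp (sumLogDensity μ m φ i.castSucc z)
          ∂(marginal (prodMeasure μ) i.castSucc)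
        = ∫ z : Fin (i + 1) → S,
          Real.exp (sumLogDensity μ m φ i.castSucc (Fin.init (α := fun _ => S) z))
          ∂((marginal (prodMeasure μ) i.succ).tilted (logDensity μ m φ i)) := by
      rw [← h2]
      exact integral_map (measurable_init i).aemeasurable h3.exp.aestronglyMeasurable
    have h5 := integral_tilted (μ := marginal (prodMeasure μ) i.succ) (logDensity μ m φ i)
      fun z : Fin (i + 1) → S =>
        Real.exp (sumLogDensity μ m φ i.castSucc (Fin.init (α := fun _ => S) z))
    rw [h1] at h5
    refine Eq.trans ?_ (h5.symm.trans (h4.symm.trans ih))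
    refine integral_congr_ae (Eventually.of_forall fun z => ?_)
    simp only [div_one, smul_eq_mul]
    rw [sumLogDensity_succ, Real.exp_add, mul_comm]

lemma integral_sumLogDensity_last (hm : ∀ i, 0 < m i) (hφ : Measurable φ)
    (hB : ∀ x, |φ x| ≤ B) :
    ∫ z : Fin (Fin.last n) → S, sumLogDensity μ m φ (Fin.last n) z ∂ν
      = ∑ i, m i * (∫ z, phi μ m φ i.succ z ∂(marginal ν i.succ)
        - ∫ z, phi μ m φ i.castSucc z ∂(marginal ν i.castSucc)) := by
  have hstep : ∀ i : Fin n, ∫ z, sumLogDensity μ m φ i.succ z ∂(marginal ν i.succ)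
      - ∫ z, sumLogDensity μ m φ i.castSucc z ∂(marginal ν i.castSucc)
      = m i * (∫ z, phi μ m φ i.succ z ∂(marginal ν i.succ)
        - ∫ z, phi μ m φ i.castSucc z ∂(marginal ν i.castSucc)) := by
    intro i
    obtain ⟨h1, C, h2⟩ := measurable_sumLogDensity μ hm hφ hB i.castSucc
    have h3 : ∫ z, sumLogDensity μ m φ i.succ z ∂(marginal ν i.succ)
        = ∫ z : Fin i.succ → S,
          (sumLogDensity μ m φ i.castSucc (Fin.init (n := i) (α := fun _ => S) z) + logDensity μ m φ i z) ∂(marginal ν i.succ) :=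
      integral_congr_ae (Eventually.of_forall fun z => sumLogDensity_succ μ m φ i z)
    have h4 : Measurable fun z : Fin i.succ → S =>
        sumLogDensity μ m φ i.castSucc (Fin.init (n := i) (α := fun _ => S) z) :=
      h1.comp (measurable_init i)
    rw [← integral_logDensity μ hm hφ hB, h3, integral_marginal_castSucc ν i h1, integral_add
      (integrable_of_abs_le h4 fun z => h2 _)
      (integrable_of_abs_le (measurable_logDensity μ hm hφ hB i)
        (abs_logDensity_le μ hm hφ hB i))]
    ring
  simp_rw [← hstep]
  rw [Fin.sum_succ_sub_castSucc fun j => ∫ z, sumLogDensity μ m φ j z ∂(marginal ν j),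
    marginal_last]
  simp_rw [sumLogDensity_zero]
  rw [integral_zero, sub_zero]

/-- The optimal measure in the Gibbs variational principle along the coordinates. -/
lemma exists_optimal_measure (hm : ∀ i, 0 < m i) (hφ : Measurable φ) (hB : ∀ x, |φ x| ≤ B) :
    ∃ ν : Measure (Fin n → S), IsProbabilityMeasure ν ∧ klDiv ν (prodMeasure μ) ≠ ∞ ∧
      ∫ x, φ x ∂ν = phiZero μ m φ
        + ∑ i, 1 / m i * (entropy μ ν i.succ - entropy μ ν i.castSucc) := by
  obtain ⟨h1, C, h2⟩ := measurable_sumLogDensity μ hm hφ hB (Fin.last n)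
  have h3 := integral_exp_sumLogDensity μ hm hφ hB (Fin.last n)
  rw [marginal_last] at h3
  have hprob : IsProbabilityMeasure
      ((prodMeasure μ).tilted (sumLogDensity μ m φ (Fin.last n))) :=
    isProbabilityMeasure_tilted (integrable_exp_of_abs_le h1 h2)
  obtain ⟨hfin, hent⟩ := klDiv_tilted_self h1 h2 h3
  refine ⟨_, hprob, hfin, ?_⟩
  set ν := (prodMeasure μ).tilted (sumLogDensity μ m φ (Fin.last n))
  have hsum := Fin.sum_succ_sub_castSucc (entropy μ ν)
  -- For this measure the total entropy equals the integral of its log density, so the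
  -- coordinatewise Gibbs inequalities sum to an equality. Each of them is therefore an equality,
  -- and no chain rule for entropy is needed.
  rw [entropy_last, entropy_zero, hent, integral_sumLogDensity_last μ hm hφ hB, sub_zero,
    eq_comm, Finset.sum_eq_sum_iff_of_le
      fun i _ => mul_integral_phi_sub_le μ hm hφ hB hfin i] at hsum
  have htel := Fin.sum_succ_sub_castSucc fun j => ∫ z, phi μ m φ j z ∂(marginal ν j)
  rw [integral_phi_zero, marginal_last, phi_last] at htel
  change _ = ∫ x : Fin n → S, φ x ∂ν - _ at htel
  have : ∑ i, 1 / m i * (entropy μ ν i.succ - entropy μ ν i.castSucc)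
      = ∑ i : Fin n, (∫ z, phi μ m φ i.succ z ∂(marginal ν i.succ)
        - ∫ z, phi μ m φ i.castSucc z ∂(marginal ν i.castSucc)) :=
    Finset.sum_congr rfl fun i hi => by
      rw [← hsum i hi, ← mul_assoc, one_div_mul_cancel (hm i).ne', one_mul]
  rw [this, htel]
  ring

/-- Weak duality. -/
lemma integral_sub_entropy_le_parisi {γ : Fin n → ℝ} (hγsum : ∑ i, γ i = 1) (hm : m ∈ Delta n)
    (hφ : Measurable φ) (hB : ∀ x, |φ x| ≤ B) (hν : klDiv ν (prodMeasure μ) ≠ ∞)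
    (hc : ∀ j : Fin n, entropy μ ν j.succ ≤ partialSum γ j * Real.log 2) :
    ∫ x, φ x ∂ν - entropy μ ν (Fin.last n) ≤ parisi μ γ m φ := by
  obtain ⟨hm0, hmono, hm1⟩ := hm
  have htel := Fin.sum_succ_sub_castSucc fun j => ∫ z, phi μ m φ j z ∂(marginal ν j)
  rw [integral_phi_zero, marginal_last, phi_last] at htel
  change _ = ∫ x : Fin n → S, φ x ∂ν - _ at htel
  have hH := Fin.sum_succ_sub_castSucc (entropy μ ν)
  rw [entropy_zero, sub_zero] at hH
  have h1 : ∑ i : Fin n, (∫ z, phi μ m φ i.succ z ∂(marginal ν i.succ)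
        - ∫ z, phi μ m φ i.castSucc z ∂(marginal ν i.castSucc))
      ≤ ∑ i, 1 / m i * (entropy μ ν i.succ - entropy μ ν i.castSucc) :=
    Finset.sum_le_sum fun i _ => by
      rw [one_div, le_inv_mul_iff₀ (hm0 i)]
      exact mul_integral_phi_sub_le μ hm0 hφ hB hν i
  -- Membership in `Delta n` says that the weights `1 / m i - 1` are nonnegative and antitone;
  -- nonnegativity of the partial sums of `d` is the family of entropy constraints.
  have h2 := Fin.sum_mul_nonneg_of_antitone (c := fun i => 1 / m i - 1)
    (d := fun i => γ i * Real.log 2 - (entropy μ ν i.succ - entropy μ ν i.castSucc))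
    (fun i j hij => sub_le_sub_right (one_div_le_one_div_of_le (hm0 i) (hmono hij)) _)
    (fun i => sub_nonneg.2 ((one_le_div (hm0 i)).2 (hm1 i)))
    (fun j => by
      rw [Finset.sum_sub_distrib, Fin.sum_Iic_succ_sub_castSucc, ← Finset.sum_mul, entropy_zero,
        sub_zero, sub_nonneg]
      exact hc j)
  have h3 : ∑ i, (1 / m i - 1) * (γ i * Real.log 2
        - (entropy μ ν i.succ - entropy μ ν i.castSucc))
      = ∑ i, γ i * Real.log 2 / m i
        - ∑ i, 1 / m i * (entropy μ ν i.succ - entropy μ ν i.castSucc)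
        - (∑ i, γ i) * Real.log 2 + ∑ i : Fin n, (entropy μ ν i.succ - entropy μ ν i.castSucc) := by
    rw [Finset.sum_mul, ← Finset.sum_sub_distrib, ← Finset.sum_sub_distrib,
      ← Finset.sum_add_distrib]
    exact Finset.sum_congr rfl fun i _ => by ring
  rw [h3, hH, hγsum] at h2
  rw [parisi]
  linarith

end GREM

/-! ### Minimax over a box of multipliers -/

section Minimax

variable {n : ℕ}

/-- The minimax theorem for a Lagrangian with multipliers ranging over a box. -/
lemma exists_forall_lt_lagrangian {Y : Set (ℝ × (Fin n → ℝ))} (hY : Convex ℝ Y)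
    {M : ℝ} (hM : 0 ≤ M) {t : ℝ}
    (h : ∀ l ∈ Set.Icc (0 : Fin n → ℝ) (fun _ => M), ∃ y ∈ Y, t < y.1 - ∑ j, l j * y.2 j) :
    ∃ y ∈ Y, ∀ l ∈ Set.Icc (0 : Fin n → ℝ) (fun _ => M), t < y.1 - ∑ j, l j * y.2 j := by
  set X := Set.Icc (0 : Fin n → ℝ) (fun _ => M)
  have hXc : IsCompact X := isCompact_Icc
  have hXne : X.Nonempty := ⟨0, Set.left_mem_Icc.2 fun _ => hM⟩
  have hXcv : Convex ℝ X := convex_Icc _ _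
  have hcl : ∀ y : ℝ × (Fin n → ℝ), Continuous fun l : Fin n → ℝ => y.1 - ∑ j, l j * y.2 j :=
    fun y => by fun_prop
  have hcy : ∀ l : Fin n → ℝ, Continuous fun y : ℝ × (Fin n → ℝ) => y.1 - ∑ j, l j * y.2 j :=
    fun l => by fun_prop
  choose! y hyY hyt using h
  -- Compactness of the box reduces the hypothesis to finitely many points of `Y`, so Sion's theorem
  -- is used without compactness of `Y`.
  obtain ⟨s, hsX, hs⟩ := hXc.elim_nhds_subcover (fun l => {l' | t < (y l).1 - ∑ j, l' j * (y l).2 j})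
    fun l hl => (isOpen_lt continuous_const (hcl (y l))).mem_nhds (hyt l hl)
  refine Sion.exists_lt_iInf_of_lt_iInf_of_finite (X := X) (Y := Y) (s := y '' s)
    (f := fun (l : Fin n → ℝ) (y : ℝ × (Fin n → ℝ)) => y.1 - ∑ j, l j * y.2 j) hXne hXc
    (fun y _ => (hcl y).lowerSemicontinuous.lowerSemicontinuousOn _)
    (fun y _ => ConvexOn.quasiconvexOn ⟨hXcv, fun a _ b _ u v _ _ huv => le_of_eq ?_⟩) hY
    (fun l _ => (hcy l).upperSemicontinuous.upperSemicontinuousOn _)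
    (fun l _ => ConcaveOn.quasiconcaveOn ⟨hY, fun a _ b _ u v _ _ huv => le_of_eq ?_⟩) hXcv
    (s.finite_toSet.image y) ?_ fun l hl => ?_
  · simp only [Pi.add_apply, Pi.smul_apply, smul_eq_mul, add_mul, mul_assoc,
      Finset.sum_add_distrib, ← Finset.mul_sum]
    linear_combination (-y.1) * huv
  · simp only [Prod.fst_add, Prod.snd_add, Prod.smul_fst, Prod.smul_snd, Pi.add_apply,
      Pi.smul_apply, smul_eq_mul, mul_add, mul_left_comm (l _), Finset.sum_add_distrib,
      ← Finset.mul_sum]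
    ring
  · rintro _ ⟨l, hl, rfl⟩
    exact hyY l (hsX l hl)
  · obtain ⟨l', hl', hlt⟩ := Set.mem_iUnion₂.1 (hs hl)
    exact ⟨y l', ⟨l', hl', rfl⟩, hlt⟩

/-- The dictionary between parameters and multipliers: with `1 / m i` as the weight on the left, the
right side exhibits `l j` as the multiplier of the `j`-th partial sum. -/
lemma sum_one_add_sum_Ici_mul (l d : Fin n → ℝ) :
    ∑ i, (1 + ∑ j ∈ Finset.Ici i, l j) * d i = ∑ i, d i + ∑ j, l j * ∑ i ∈ Finset.Iic j, d i := by
  simp_rw [add_mul, one_mul, Finset.sum_add_distrib, Finset.sum_mul, Finset.mul_sum]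
  congr 1
  exact Finset.sum_comm' fun i j => by simp

end Minimax

/-! ### The penalized problem and its limit -/

namespace GREM

variable {S : Type*} [MeasurableSpace S] {n : ℕ}

lemma isProbabilityMeasure_combination {Ω : Type*} [MeasurableSpace Ω] {ν₁ ν₂ : Measure Ω}
    [IsProbabilityMeasure ν₁] [IsProbabilityMeasure ν₂] {a b : ℝ≥0} (hab : a + b = 1) :
    IsProbabilityMeasure (a • ν₁ + b • ν₂) :=
  ⟨by
    rw [Measure.add_apply, Measure.smul_apply, Measure.smul_apply, measure_univ, measure_univ,
      ← add_smul, hab, one_smul]⟩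

lemma marginal_combination (ν₁ ν₂ : Measure (Fin n → S)) (a b : ℝ≥0) (j : Fin (n + 1)) :
    marginal (a • ν₁ + b • ν₂) j = a • marginal ν₁ j + b • marginal ν₂ j := by
  unfold marginal
  rw [Measure.map_add _ _ (measurable_take j), Measure.map_smul, Measure.map_smul]

lemma integral_combination {Ω : Type*} [MeasurableSpace Ω] {ν₁ ν₂ : Measure Ω}
    [IsProbabilityMeasure ν₁] [IsProbabilityMeasure ν₂] (a b : ℝ≥0) {φ : Ω → ℝ} {B : ℝ}
    (hφ : Measurable φ) (hB : ∀ x, |φ x| ≤ B) :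
    ∫ x, φ x ∂(a • ν₁ + b • ν₂) = a * ∫ x, φ x ∂ν₁ + b * ∫ x, φ x ∂ν₂ := by
  rw [integral_add_measure (integrable_of_abs_le hφ hB) (integrable_of_abs_le hφ hB),
    integral_smul_nnreal_measure, integral_smul_nnreal_measure]
  rfl

variable (μ : Fin n → Measure S) {φ : (Fin n → S) → ℝ} {B : ℝ}

/-- The objective function with a penalty of slope `M` for violating the entropy constraints. -/
noncomputable def penalized (γ : Fin n → ℝ) (φ : (Fin n → S) → ℝ) (M : ℝ)
    (ν : Measure (Fin n → S)) : ℝ :=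
  ∫ x, φ x ∂ν - entropy μ ν (Fin.last n)
    - M * ∑ j : Fin n, max (entropy μ ν j.succ - partialSum γ j * Real.log 2) 0

lemma entropy_nonneg (ν : Measure (Fin n → S)) (j : Fin (n + 1)) : 0 ≤ entropy μ ν j :=
  ENNReal.toReal_nonneg

lemma sum_max_nonneg (γ : Fin n → ℝ) (ν : Measure (Fin n → S)) :
    0 ≤ ∑ j : Fin n, max (entropy μ ν j.succ - partialSum γ j * Real.log 2) 0 :=
  Finset.sum_nonneg fun _ _ => le_max_right _ _

lemma penalized_anti (γ : Fin n → ℝ) (ν : Measure (Fin n → S)) :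
    Antitone fun M => penalized μ γ φ M ν := fun _ _ h =>
  sub_le_sub_left (mul_le_mul_of_nonneg_right h (sum_max_nonneg μ γ ν)) _

lemma integral_le_of_abs_le {Ω : Type*} [MeasurableSpace Ω] {ν : Measure Ω}
    [IsProbabilityMeasure ν] {f : Ω → ℝ} (hB : ∀ x, |f x| ≤ B) : ∫ x, f x ∂ν ≤ B := by
  have h := norm_integral_le_of_norm_le_const (μ := ν) (f := f) (Eventually.of_forall hB)
  rw [probReal_univ, mul_one] at h
  exact (le_abs_self _).trans h

lemma penalized_le (γ : Fin n → ℝ) (hB : ∀ x, |φ x| ≤ B) {M : ℝ}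
    (hM : 0 ≤ M) (ν : Measure (Fin n → S)) [IsProbabilityMeasure ν] :
    penalized μ γ φ M ν ≤ B := by
  have h1 := integral_le_of_abs_le (ν := ν) hB
  have h2 := mul_nonneg hM (sum_max_nonneg μ γ ν)
  have h3 := entropy_nonneg μ ν (Fin.last n)
  unfold penalized
  linarith

variable [∀ i, IsProbabilityMeasure (μ i)]

lemma entropy_combination_le {ν₁ ν₂ : Measure (Fin n → S)} [IsProbabilityMeasure ν₁]
    [IsProbabilityMeasure ν₂] (h1 : klDiv ν₁ (prodMeasure μ) ≠ ∞)
    (h2 : klDiv ν₂ (prodMeasure μ) ≠ ∞) {a b : ℝ≥0} (hab : a + b = 1) (j : Fin (n + 1)) :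
    entropy μ (a • ν₁ + b • ν₂) j ≤ a * entropy μ ν₁ j + b * entropy μ ν₂ j := by
  unfold entropy
  rw [marginal_combination]
  exact toReal_klDiv_combination_le hab (klDiv_marginal_ne_top μ h1 j)
    (klDiv_marginal_ne_top μ h2 j)

/-- For every bound on the multipliers, the dual value is nearly attained by a measure. -/
lemma exists_lt_penalized {γ : Fin n → ℝ} (hγsum : ∑ i, γ i = 1) (hφ : Measurable φ)
    (hB : ∀ x, |φ x| ≤ B) {p : ℝ} (hp : ∀ m ∈ Delta n, p ≤ parisi μ γ m φ) {M t : ℝ}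
    (hM : 0 ≤ M) (ht : t < p) :
    ∃ ν : Measure (Fin n → S), IsProbabilityMeasure ν ∧ klDiv ν (prodMeasure μ) ≠ ∞ ∧
      t < penalized μ γ φ M ν := by
  -- Pairs of value and constraint excess, relaxed to inequalities: convexity of entropy then makes
  -- `Y` convex, which the set of exact pairs need not be.
  let Y : Set (ℝ × (Fin n → ℝ)) := {y | ∃ ν : Measure (Fin n → S), IsProbabilityMeasure ν ∧
    klDiv ν (prodMeasure μ) ≠ ∞ ∧ y.1 ≤ ∫ x, φ x ∂ν - entropy μ ν (Fin.last n) ∧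
    ∀ j : Fin n, entropy μ ν j.succ - partialSum γ j * Real.log 2 ≤ y.2 j}
  have hY : Convex ℝ Y := by
    rintro y₁ ⟨ν₁, hν₁, hf₁, hv₁, he₁⟩ y₂ ⟨ν₂, hν₂, hf₂, hv₂, he₂⟩ a b ha hb hab
    lift a to ℝ≥0 using ha
    lift b to ℝ≥0 using hb
    have hab' : a + b = 1 := by exact_mod_cast hab
    refine ⟨a • ν₁ + b • ν₂, isProbabilityMeasure_combination hab',
      klDiv_combination_ne_top hab' hf₁ hf₂, ?_, fun j => ?_⟩
    · have h1 := entropy_combination_le μ hf₁ hf₂ hab' (Fin.last n)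
      have h2 := mul_le_mul_of_nonneg_left hv₁ a.coe_nonneg
      have h3 := mul_le_mul_of_nonneg_left hv₂ b.coe_nonneg
      rw [integral_combination a b hφ hB]
      simp only [Prod.fst_add, Prod.smul_fst, smul_eq_mul]
      linarith
    · have h1 := entropy_combination_le μ hf₁ hf₂ hab' j.succ
      have h2 := mul_le_mul_of_nonneg_left (he₁ j) a.coe_nonneg
      have h3 := mul_le_mul_of_nonneg_left (he₂ j) b.coe_nonneg
      have h4 : partialSum γ j * Real.log 2 = a * (partialSum γ j * Real.log 2)
        + b * (partialSum γ j * Real.log 2) := by rw [← add_mul, hab, one_mul]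
      simp only [Prod.snd_add, Prod.smul_snd, Pi.add_apply, Pi.smul_apply, smul_eq_mul]
      linarith
  obtain ⟨y, ⟨ν, hν, hf, hv, he⟩, hy⟩ := exists_forall_lt_lagrangian (t := t) hY hM fun l hl => by
    have hl0 : ∀ j, 0 ≤ l j := hl.1
    have hw : ∀ i, 1 ≤ 1 + ∑ j ∈ Finset.Ici i, l j := fun i =>
      le_add_of_nonneg_right (Finset.sum_nonneg fun j _ => hl0 j)
    set m : Fin n → ℝ := fun i => 1 / (1 + ∑ j ∈ Finset.Ici i, l j) with hm
    have hm0 : ∀ i, 0 < m i := fun i => one_div_pos.2 (one_pos.trans_le (hw i))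
    have hmw : ∀ i, 1 / m i = 1 + ∑ j ∈ Finset.Ici i, l j := fun i => one_div_one_div _
    have hmD : m ∈ Delta n := by
      refine ⟨hm0, fun i k hik => ?_, fun i => ?_⟩
      · refine one_div_le_one_div_of_le (one_pos.trans_le (hw k)) (add_le_add_right ?_ _)
        exact Finset.sum_le_sum_of_subset_of_nonneg (Finset.Ici_subset_Ici.2 hik)
          fun j _ _ => hl0 j
      · exact (div_le_one (one_pos.trans_le (hw i))).2 (hw i)
    obtain ⟨ν, hν, hf, hφν⟩ := exists_optimal_measure μ hm0 hφ hB
    refine ⟨(∫ x, φ x ∂ν - entropy μ ν (Fin.last n),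
      fun j => entropy μ ν j.succ - partialSum γ j * Real.log 2),
      ⟨ν, hν, hf, le_rfl, fun j => le_rfl⟩, ht.trans_le ((hp m hmD).trans (le_of_eq ?_))⟩
    -- For the `m` built from `l`, the Lagrangian at the optimal measure is exactly `parisi μ γ m
    -- φ`.
    simp_rw [hmw] at hφν
    rw [sum_one_add_sum_Ici_mul, Fin.sum_succ_sub_castSucc, entropy_zero, sub_zero] at hφν
    simp_rw [Fin.sum_Iic_succ_sub_castSucc, entropy_zero, sub_zero] at hφν
    have hg : ∑ i, γ i * Real.log 2 / m i
        = Real.log 2 + ∑ j, l j * (partialSum γ j * Real.log 2) := by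
      have : ∀ i, γ i * Real.log 2 / m i
          = (1 + ∑ j ∈ Finset.Ici i, l j) * (γ i * Real.log 2) := fun i => by
        rw [← hmw i]; ring
      simp_rw [this]
      rw [sum_one_add_sum_Ici_mul, ← Finset.sum_mul, hγsum, one_mul]
      simp_rw [← Finset.sum_mul]
      rfl
    rw [parisi, hg, hφν]
    simp only [mul_sub, Finset.sum_sub_distrib]
    ring
  refine ⟨ν, hν, hf, ?_⟩
  -- The worst multiplier in the box is `M` on violated constraints and `0` elsewhere, which turns
  -- the Lagrangian into the penalty.
  have h1 := hy (fun j => if 0 < entropy μ ν j.succ - partialSum γ j * Real.log 2 then M else 0)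
    ⟨fun j => by dsimp only [Pi.zero_apply]; split_ifs <;> simp [hM],
      fun j => by dsimp only; split_ifs <;> simp [hM]⟩
  refine h1.trans_le ?_
  rw [penalized, Finset.mul_sum]
  refine sub_le_sub hv (Finset.sum_le_sum fun j _ => ?_)
  split_ifs with h
  · rw [max_eq_left h.le]
    exact mul_le_mul_of_nonneg_left (he j) hM
  · rw [max_eq_right (not_lt.1 h)]
    simp

/-- The penalized objective is concave, with a gap at midpoints at least that of the entropy. -/
lemma penalized_midpoint {γ : Fin n → ℝ} (hφ : Measurable φ) (hB : ∀ x, |φ x| ≤ B) {M : ℝ}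
    (hM : 0 ≤ M) {ν₁ ν₂ : Measure (Fin n → S)} [IsProbabilityMeasure ν₁]
    [IsProbabilityMeasure ν₂] (h1 : klDiv ν₁ (prodMeasure μ) ≠ ∞)
    (h2 : klDiv ν₂ (prodMeasure μ) ≠ ∞) :
    1 / 2 * penalized μ γ φ M ν₁ + 1 / 2 * penalized μ γ φ M ν₂
      + (1 / 2 * entropy μ ν₁ (Fin.last n) + 1 / 2 * entropy μ ν₂ (Fin.last n)
        - entropy μ ((1 / 2 : ℝ≥0) • ν₁ + (1 / 2 : ℝ≥0) • ν₂) (Fin.last n))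
      ≤ penalized μ γ φ M ((1 / 2 : ℝ≥0) • ν₁ + (1 / 2 : ℝ≥0) • ν₂) := by
  have hsum : ∑ j : Fin n, max (entropy μ ((1 / 2 : ℝ≥0) • ν₁ + (1 / 2 : ℝ≥0) • ν₂) j.succ
        - partialSum γ j * Real.log 2) 0
      ≤ 1 / 2 * ∑ j : Fin n, max (entropy μ ν₁ j.succ - partialSum γ j * Real.log 2) 0
        + 1 / 2 * ∑ j : Fin n, max (entropy μ ν₂ j.succ - partialSum γ j * Real.log 2) 0 := by
    rw [Finset.mul_sum, Finset.mul_sum, ← Finset.sum_add_distrib]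
    refine Finset.sum_le_sum fun j _ => ?_
    have h3 := entropy_combination_le μ h1 h2 (add_halves (1 : ℝ≥0)) j.succ
    have h4 := le_max_left (entropy μ ν₁ j.succ - partialSum γ j * Real.log 2) 0
    have h5 := le_max_left (entropy μ ν₂ j.succ - partialSum γ j * Real.log 2) 0
    have h6 := le_max_right (entropy μ ν₁ j.succ - partialSum γ j * Real.log 2) 0
    have h7 := le_max_right (entropy μ ν₂ j.succ - partialSum γ j * Real.log 2) 0
    push_cast at h3
    exact max_le (by linarith) (by linarith)
  have h8 := mul_le_mul_of_nonneg_left hsum hM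
  unfold penalized
  rw [integral_combination _ _ hφ hB]
  push_cast
  linarith

/-- Nearly optimal measures for increasing penalties form a Cauchy sequence in total variation. -/
lemma exists_penalized_cauchy {γ : Fin n → ℝ} (hγsum : ∑ i, γ i = 1) (hφ : Measurable φ)
    (hB : ∀ x, |φ x| ≤ B) {p : ℝ} (hp : ∀ m ∈ Delta n, p ≤ parisi μ γ m φ) :
    ∃ νs : ℕ → Measure (Fin n → S), (∀ k, IsProbabilityMeasure (νs k)) ∧
      (∀ k, klDiv (νs k) (prodMeasure μ) ≠ ∞) ∧
      (∀ k : ℕ, p - 1 / ((k : ℝ) + 1) ≤ penalized μ γ φ ((k : ℝ) + 1) (νs k)) ∧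
      ∀ ε > 0, ∃ N, ∀ k ≥ N, ∀ l ≥ N,
        ∫ x, |((νs k).rnDeriv (prodMeasure μ) x).toReal
          - ((νs l).rnDeriv (prodMeasure μ) x).toReal| ∂(prodMeasure μ) < ε := by
  let V : ℕ → Set ℝ := fun k => {v | ∃ ν : Measure (Fin n → S), IsProbabilityMeasure ν ∧
    klDiv ν (prodMeasure μ) ≠ ∞ ∧ penalized μ γ φ ((k : ℝ) + 1) ν = v}
  have hpos : ∀ k : ℕ, (0 : ℝ) < (k : ℝ) + 1 := fun k => by positivity
  have hbdd : ∀ k, BddAbove (V k) := fun k => ⟨B, by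
    rintro _ ⟨ν, hν, -, rfl⟩
    exact penalized_le μ γ hB (hpos k).le ν⟩
  have hne : ∀ k, (V k).Nonempty := fun k => by
    obtain ⟨ν, hν, hf, -⟩ := exists_lt_penalized μ hγsum hφ hB hp (hpos k).le (sub_one_lt p)
    exact ⟨_, ν, hν, hf, rfl⟩
  have hle : ∀ (k : ℕ) (ν : Measure (Fin n → S)), IsProbabilityMeasure ν →
      klDiv ν (prodMeasure μ) ≠ ∞ → penalized μ γ φ ((k : ℝ) + 1) ν ≤ sSup (V k) :=
    fun k ν hν hf => le_csSup (hbdd k) ⟨ν, hν, hf, rfl⟩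
  have hpV : ∀ k, p ≤ sSup (V k) := fun k => le_of_forall_lt fun t ht => by
    obtain ⟨ν, hν, hf, hlt⟩ := exists_lt_penalized μ hγsum hφ hB hp (hpos k).le ht
    exact hlt.trans_le (hle k ν hν hf)
  have hanti : Antitone fun k => sSup (V k) := fun k l hkl => csSup_le (hne l) (by
    rintro _ ⟨ν, hν, hf, rfl⟩
    exact (penalized_anti μ γ ν (by gcongr)).trans (hle k ν hν hf))
  have hex : ∀ k : ℕ, ∃ ν : Measure (Fin n → S), IsProbabilityMeasure ν ∧
      klDiv ν (prodMeasure μ) ≠ ∞ ∧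
      sSup (V k) - 1 / ((k : ℝ) + 1) < penalized μ γ φ ((k : ℝ) + 1) ν := fun k => by
    obtain ⟨_, ⟨ν, hν, hf, rfl⟩, h⟩ :=
      exists_lt_of_lt_csSup (hne k) (sub_lt_self (sSup (V k)) (one_div_pos.2 (hpos k)))
    exact ⟨ν, hν, hf, h⟩
  choose νs hprob hfin hlt using hex
  refine ⟨νs, hprob, hfin, fun k => (sub_le_sub_right (hpV k) _).trans (hlt k).le, fun ε hε => ?_⟩
  have hlim : Tendsto (fun k => sSup (V k)) atTop (𝓝 (⨅ k, sSup (V k))) :=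
    tendsto_atTop_ciInf hanti ⟨p, by rintro _ ⟨k, rfl⟩; exact hpV k⟩
  have hinf : ∀ k, (⨅ k, sSup (V k)) ≤ sSup (V k) :=
    fun k => ciInf_le ⟨p, by rintro _ ⟨k, rfl⟩; exact hpV k⟩ k
  set L := ⨅ k, sSup (V k)
  -- The final bound is `2 / η * (η ^ 2 / 2) + 2 * η = 3 * η`, which is below `ε`.
  set η := ε / 4 with hη
  have hη0 : 0 < η := by positivity
  have hlim2 : Tendsto (fun k : ℕ => sSup (V k) - L + 1 / ((k : ℝ) + 1)) atTop (𝓝 0) := by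
    simpa using (hlim.sub_const L).add tendsto_one_div_add_atTop_nhds_zero_nat
  obtain ⟨N, hN⟩ := ((tendsto_order.1 hlim2).2 (η ^ 2 / 2) (by positivity)).exists
  refine ⟨N, fun k hk l hl => ?_⟩
  -- Lowering the penalty only raises the objective, so all later measures are nearly optimal for
  -- the single penalty `N + 1`. Their midpoint cannot exceed `sSup (V N)`, which forces a small
  -- entropy gap.
  have hnear : ∀ k ≥ N, L - 1 / ((N : ℝ) + 1) ≤ penalized μ γ φ ((N : ℝ) + 1) (νs k) := by
    intro k hk
    have h1 : (N : ℝ) + 1 ≤ (k : ℝ) + 1 := by gcongr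
    have h2 := penalized_anti μ (φ := φ) γ (νs k) h1
    have h3 := one_div_le_one_div_of_le (hpos N) h1
    have h4 := hinf k
    have h5 := hlt k
    dsimp only at h2
    linarith
  have hmid := penalized_midpoint μ (γ := γ) hφ hB (hpos N).le (hfin k) (hfin l)
  have hprobm := isProbabilityMeasure_combination (ν₁ := νs k) (ν₂ := νs l) (add_halves (1 : ℝ≥0))
  have hsup := hle N _ hprobm
    (klDiv_combination_ne_top (add_halves (1 : ℝ≥0)) (hfin k) (hfin l))
  have hbd := integral_abs_rnDeriv_sub_le (hfin k) (hfin l) hη0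
  rw [← entropy_last, ← entropy_last, ← entropy_last] at hbd
  have hk' := hnear k hk
  have hl' := hnear l hl
  have hgap : 1 / 2 * entropy μ (νs k) (Fin.last n) + 1 / 2 * entropy μ (νs l) (Fin.last n)
      - entropy μ ((1 / 2 : ℝ≥0) • νs k + (1 / 2 : ℝ≥0) • νs l) (Fin.last n) ≤ η ^ 2 / 2 := by
    linarith
  have := mul_le_mul_of_nonneg_left hgap (by positivity : 0 ≤ 2 / η)
  have h6 : 2 / η * (η ^ 2 / 2) = η := by field_simp
  linarith

/-- The primal supremum is attained and dominates every lower bound of the dual problem. -/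
lemma exists_feasible_ge {γ : Fin n → ℝ} (hγsum : ∑ i, γ i = 1)
    (hφ : Measurable φ) (hB : ∀ x, |φ x| ≤ B) {p : ℝ} (hp : ∀ m ∈ Delta n, p ≤ parisi μ γ m φ) :
    ∃ ν : Measure (Fin n → S), IsProbabilityMeasure ν ∧ klDiv ν (prodMeasure μ) ≠ ∞ ∧
      (∀ j : Fin n, klDiv (marginal ν j.succ) (marginal (prodMeasure μ) j.succ)
        ≤ ENNReal.ofReal (partialSum γ j * Real.log 2)) ∧
      p ≤ ∫ x, φ x ∂ν - entropy μ ν (Fin.last n) := by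
  obtain ⟨νs, hprob, hfin, hpen, hcau⟩ := exists_penalized_cauchy μ hγsum hφ hB hp
  have hac : ∀ k, νs k ≪ prodMeasure μ := fun k => (klDiv_ne_top_iff.1 (hfin k)).1
  obtain ⟨ρ, hρ, hρac, hlim⟩ := exists_tendsto_eLpNorm_rnDeriv hac hcau
  have hpos : ∀ k : ℕ, (0 : ℝ) < (k : ℝ) + 1 := fun k => by positivity
  have hone : Tendsto (fun k : ℕ => 1 / ((k : ℝ) + 1)) atTop (𝓝 0) :=
    tendsto_one_div_add_atTop_nhds_zero_nat
  have hkl : ∀ k j, klDiv (marginal (νs k) j) (marginal (prodMeasure μ) j)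
      = ENNReal.ofReal (entropy μ (νs k) j) := fun k j =>
    (ENNReal.ofReal_toReal (klDiv_marginal_ne_top μ (hfin k) j)).symm
  have hent : ∀ k : ℕ, entropy μ (νs k) (Fin.last n)
      ≤ ∫ x, φ x ∂(νs k) - (p - 1 / ((k : ℝ) + 1)) := fun k => by
    have h1 := hpen k
    have h2 := mul_nonneg (hpos k).le (sum_max_nonneg μ γ (νs k))
    unfold penalized at h1
    linarith
  have hval : Tendsto (fun k : ℕ => ∫ x, φ x ∂(νs k) - (p - 1 / ((k : ℝ) + 1))) atTop
      (𝓝 (∫ x, φ x ∂ρ - p)) := by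
    simpa using (tendsto_integral_of_tendsto_eLpNorm hac hρac hlim hφ hB).sub
      (tendsto_const_nhds (x := p) |>.sub hone)
  have hlast := klDiv_map_le_of_tendsto hac hρac hlim (measurable_take (Fin.last n))
    (fun k => (hkl k (Fin.last n)).trans_le (ENNReal.ofReal_le_ofReal (hent k)))
    (ENNReal.tendsto_ofReal hval)
  have hlast' : klDiv ρ (prodMeasure μ) ≤ ENNReal.ofReal (∫ x, φ x ∂ρ - p) := by
    have : klDiv (marginal ρ (Fin.last n)) (marginal (prodMeasure μ) (Fin.last n))
      ≤ ENNReal.ofReal (∫ x, φ x ∂ρ - p) := hlast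
    rwa [marginal_last, marginal_last] at this
  refine ⟨ρ, hρ, ne_top_of_le_ne_top ENNReal.ofReal_ne_top hlast', fun j => ?_, ?_⟩
  -- The penalized value is at least `p - 1` and the unpenalized one at most `B`, so slope `k + 1`
  -- leaves a violation of at most `(B - p + 1) / (k + 1)`.
  · have hbound : ∀ k : ℕ, entropy μ (νs k) j.succ
        ≤ partialSum γ j * Real.log 2 + (B - p + 1) * (1 / ((k : ℝ) + 1)) := fun k => by
      have h1 := hpen k
      have h2 := integral_le_of_abs_le (ν := νs k) hB
      have h3 := entropy_nonneg μ (νs k) (Fin.last n)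
      have h4 : 1 / ((k : ℝ) + 1) ≤ 1 := (div_le_one (hpos k)).2 (by simp)
      have h5 := Finset.single_le_sum
        (f := fun j : Fin n => max (entropy μ (νs k) j.succ - partialSum γ j * Real.log 2) 0)
        (fun _ _ => le_max_right _ _) (Finset.mem_univ j)
      have h6 := (le_max_left (entropy μ (νs k) j.succ - partialSum γ j * Real.log 2) 0).trans h5
      have h7 := mul_le_mul_of_nonneg_left h6 (hpos k).le
      unfold penalized at h1
      have h8 : ((k : ℝ) + 1) * (entropy μ (νs k) j.succ - partialSum γ j * Real.log 2)
        ≤ B - p + 1 := by linarith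
      rw [mul_comm, ← le_div_iff₀ (hpos k), div_eq_mul_one_div] at h8
      linarith
    refine klDiv_map_le_of_tendsto hac hρac hlim (measurable_take j.succ)
      (fun k => (hkl k j.succ).trans_le (ENNReal.ofReal_le_ofReal (hbound k)))
      (ENNReal.tendsto_ofReal ?_)
    simpa using (hone.const_mul (B - p + 1)).const_add (partialSum γ j * Real.log 2)
  -- `ENNReal.ofReal` truncates at zero, so the sign is needed before returning to real numbers.
  · have h0 : 0 ≤ ∫ x, φ x ∂ρ - p :=
      ge_of_tendsto' hval fun k => (entropy_nonneg μ (νs k) _).trans (hent k)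
    have := ENNReal.toReal_mono ENNReal.ofReal_ne_top hlast'
    rw [ENNReal.toReal_ofReal h0, ← entropy_last] at this
    linarith

end GREM

theorem theorem2 {S : Type*} [TopologicalSpace S] [PolishSpace S] [MeasurableSpace S]
    [BorelSpace S] {n : ℕ} (μ : Fin n → Measure S) [∀ i, IsProbabilityMeasure (μ i)]
    (γ : Fin n → ℝ) (hγ : ∀ i, 0 ≤ γ i) (hγsum : ∑ i, γ i = 1)
    (φ : BoundedContinuousFunction (Fin n → S) ℝ) :
    GREM.legendre μ γ φ = ⨅ m ∈ GREM.Delta n, ((GREM.parisi μ γ m φ : ℝ) : EReal) := by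
  have hφ : Measurable φ := φ.continuous.measurable
  have hB : ∀ x, |φ x| ≤ ‖φ‖ := φ.norm_coe_le_norm
  have hcoe : ∀ ν : Measure (Fin n → S), klDiv ν (GREM.prodMeasure μ) ≠ ∞ →
      ((klDiv ν (GREM.prodMeasure μ) : ℝ≥0∞) : EReal)
        = ((GREM.entropy μ ν (Fin.last n) : ℝ) : EReal) := fun ν hν => by
    rw [GREM.entropy_last, EReal.coe_ennreal_toReal hν]
  refine le_antisymm (iSup_le fun ν => le_iInf₂ fun m hm => ?_) ?_
  · by_cases hν : ν ∈ ⋂ j : Fin n, GREM.entropyConstraint μ γ j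
    swap; · simp [GREM.rate, hν]
    by_cases hfin : klDiv (ν : Measure (Fin n → S)) (GREM.prodMeasure μ) = ∞
    · simp [GREM.rate, hν, hfin]
    rw [GREM.rate, if_pos hν, hcoe _ hfin, ← EReal.coe_sub, EReal.coe_le_coe_iff]
    refine GREM.integral_sub_entropy_le_parisi μ hγsum hm hφ hB hfin fun j => ?_
    exact ENNReal.toReal_le_of_le_ofReal
      (mul_nonneg (Finset.sum_nonneg fun k _ => hγ k) (Real.log_nonneg one_le_two))
      (Set.mem_iInter.1 hν j)
  · by_contra! hlt
    -- A real `p` strictly between the two sides lies below every Parisi value, hence is reached by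
    -- a feasible measure.
    obtain ⟨p, hp1, hp2⟩ := EReal.lt_iff_exists_real_btwn.1 hlt
    obtain ⟨ν, hν, hfin, hc, hle⟩ := GREM.exists_feasible_ge μ hγsum hφ hB (p := p)
      fun m hm => EReal.coe_le_coe_iff.1 (hp2.le.trans (iInf₂_le m hm))
    refine hp1.not_ge ((EReal.coe_le_coe_iff.2 hle).trans ?_)
    refine le_trans (le_of_eq ?_) (le_iSup _ (⟨ν, hν⟩ : ProbabilityMeasure (Fin n → S)))
    have hrate : GREM.rate μ γ ⟨ν, hν⟩ = klDiv ν (GREM.prodMeasure μ) :=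
      if_pos (Set.mem_iInter.2 hc)
    rw [hrate, EReal.coe_sub, ← hcoe ν hfin]
    rfl
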